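/- **Theorem (Lutris Safety).** In every run of the Lutris protocol described below, for every epoch $e$ and any two correct validators $v,w$ of epoch $e$ that enter epoch $e$ (possibly at different times), the stores of $v$ at the moment it enters epoch $e$ are equal to the stores of $w$ at the moment it enters epoch $e$. The stores are the object store, the owned-object locks, the shared-object locks, the next-shared-lock table, and the map from executed transactions to their certificates and effects, where two certificates for the same transaction and epoch count as equal whoever signed them. **Validators and faults.** Each epoch $e$ has a finite committee whose members hold stakes. A *quorum* is a set of members holding more than $2/3$ of the total stake of the committee (so $2f+1$ of $3f+1$ validators of stake one). In each epoch an adversary corrupts members holding less than $1/3$ of the stake; the other members are the *correct validators of epoch $e$*. Corrupted validators behave arbitrarily, but signatures of correct validators cannot be forged. The adversary schedules all steps and messages. Consensus is a black box that outputs, in each epoch, one growing sequence of commits (lists of certificates and of calls of the reconfiguration contract), of which every correct node processes prefixes. **Objects and transactions.** An object has an identifier, a version, contents, the digest of the last transaction that wrote it, and is owned (by an address or by a parent object), shared (with an initial version), or read-only. The object store holds the latest version of each object; a deleted object leaves a tombstone of version $0$, which counts as missing. A transaction lists owned inputs (identifier and version, one of them the gas object), read-only inputs (identifier), shared inputs (identifier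 and initial version), a sender and a payload. It is valid if no owned or shared input is repeated, each owned input belongs to the sender or is a child of another owned or shared input, the user's signature verifies and gas suffices. Executing it on its loaded inputs is a deterministic function; the outputs get version $1+\max$ of the versions of the owned and shared inputs (deleted ones get $0$), and the owned and shared inputs that are not among the outputs disappear from the store (they are wrapped in other objects). The platform is assumed sound: digests of transactions and derived object identifiers have no collisions; when the owned and shared inputs of a transaction contain no identifier twice, and contain none of the identifiers derived from that transaction's own digest, its outputs contain no identifier twice (wrapped objects included), and only identifiers that occur in the owned and shared inputs or are derived from the transaction's digest. **Within an epoch.** (1) A correct validator signs a transaction if all its inputs are in its object store (owned inputs at the stated version, read-only ones read-only, shared ones with the stated initial version), it is valid, and each owned input key is unlocked or locked for the same transaction; it then locks these keys for it. It stops signing once a quorum of the next committee is ready. (2) A certificate is a transaction with the signatures of a quorum for epoch $e$. A correct validator may execute a certificate of the current epoch whenever all inputs are in its store and each shared input has exactly the version locked for this transaction; it then updates its store atomically, opens the locks of the newly written owned objects (and, if execution failed, of the inputs), and records the execution. Owned-object transactions need not wait for consensus; after signing has stopped, only sequenced certificates are executed. (3) On processing a sequenced certificate whose shared locks are not yet assigned,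 a node locks each shared input at its entry in the next-shared-lock table (or at the initial version, if there is none) and sets that entry to one plus the maximum of these versions and the owned input versions. (4) A deterministic rule picks commits that close checkpoints. The checkpoint of a segment of commits is formed when all its transactions and their causal dependencies have been sequenced; it consists of those that are not yet in a checkpoint, in a canonical causal order. **Reconfiguration.** Once the epoch has a prescribed number of checkpoints, members of the next committee may call *ready*. After a quorum of them is ready, validators of the current committee call *end-of-epoch*; a correct one does so only when every transaction it has executed in the epoch has been sequenced. After a quorum of these calls and one further checkpoint, a call of *handover* ends the epoch. A correct validator of epochs $e$ and $e+1$ enters epoch $e+1$ after executing all checkpointed transactions of epoch $e$; it rolls back, latest first, all executions of epoch $e$ that are in no checkpoint, clears tombstones and drops all owned-object and shared-object locks. A correct validator of epoch $e+1$ that was not a correct validator of epoch $e$ enters with the stores of a full node, which processes the consensus output of all earlier epochs from genesis and executes the checkpointed transactions. In epoch $0$ all correct validators start with the genesis stores: no locks, no executed transactions, and an object store whose objects are filed under their identifiers, have versions at least $1$ and no last transaction, and in which no identifier occurs twice (wrapped objects included) or is one that a transaction could derive. -/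

import Mathlib

universe u

namespace Lutris

/-! ## Objects, transactions, certificates -/

/-- The basic sorts of the system: validator identities, object identifiers, account addresses
(public keys), object contents, smart-contract calls, execution summaries and digests. -/
structure Sorts : Type (u + 1) where
  Val : Type u
  ObjID : Type u
  Addr : Type u
  Data : Type u
  Payload : Type u
  Summary : Type u
  Digest : Type u
  [decVal : DecidableEq Val]
  [decObjID : DecidableEq ObjID]
  [decDigest : DecidableEq Digest]

attribute [instance] Sorts.decVal Sorts.decObjID Sorts.decDigest

variable {C : Sorts.{u}}

/-- Versions are Lamport timestamps; version `0` marks a tombstone (deleted object). -/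
abbrev Version := ℕ

/-- An object key: identifier and version. -/
abbrev ObjKey (C : Sorts.{u}) := C.ObjID × Version

/-- Ownership: owned by an address, owned by a parent object (child object), shared (with the
version at which the object was first shared), or read-only. -/
inductive Owner (C : Sorts.{u}) : Type u where
  | address (a : C.Addr)
  | object (parent : C.ObjID)
  | shared (initial : Version)
  | immutable

/-- `o` is owned, by an address or by a parent object. -/
def Owner.isOwned : Owner C → Bool
  | .address _ => true
  | .object _ => true
  | _ => false

def Owner.isImmutable : Owner C → Bool
  | .immutable => true
  | _ => false

def Owner.isSharedFrom (iv : Version) : Owner C → Bool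
  | .shared w => w == iv
  | _ => false

structure Obj (C : Sorts.{u}) : Type u where
  id : C.ObjID
  version : Version
  owner : Owner C
  data : C.Data
  /-- digest of the transaction that created or last mutated the object; `none` at genesis -/
  lastTx : Option C.Digest

def Obj.key (o : Obj C) : ObjKey C := (o.id, o.version)

/-- A user transaction. `inputs` are the keys of the owned inputs, among them the gas object. The
user's signature is regarded as a part of `payload`. -/
structure Tx (C : Sorts.{u}) : Type u where
  sender : C.Addr
  inputs : List (ObjKey C)
  gas : ObjKey C
  readonly : List C.ObjID
  /-- shared inputs: identifier and initial version -/
  shared : List (C.ObjID × Version)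
  payload : C.Payload

/-- A transaction certificate: a transaction, an epoch, and the validators whose signatures on
the transaction for that epoch it carries. -/
structure Cert (C : Sorts.{u}) : Type u where
  tx : Tx C
  epoch : ℕ
  signers : Finset C.Val

/-! ## The execution platform -/

/-- An object output by the virtual machine, before the validator stamps its version. -/
structure OutObj (C : Sorts.{u}) : Type u where
  id : C.ObjID
  owner : Owner C
  data : C.Data
  deleted : Bool

/-- The result of running a transaction. A mutable input whose identifier does not occur in `out`
has been wrapped into another object. -/
structure Outcome (C : Sorts.{u}) : Type u where
  success : Bool
  out : List (OutObj C)
  summary : C.Summary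

/-- Hash functions and virtual machine. The virtual machine is a function, i.e. deterministic. -/
structure Platform (C : Sorts.{u}) : Type u where
  digest : Tx C → C.Digest
  /-- identifier of the `k`-th object created by the transaction with the given digest -/
  newId : C.Digest → ℕ → C.ObjID
  /-- all identifiers of objects wrapped, at any depth, inside the given contents -/
  wrapped : C.Data → Finset C.ObjID
  /-- the user's signature verifies, and sufficient gas is available in the given inputs -/
  admissible : Tx C → List (Obj C) → Prop
  /-- run a transaction on its loaded owned, read-only and shared inputs, in this order -/
  run : Tx C → List (Obj C) → List (Obj C) → List (Obj C) → Outcome C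

/-- The identifiers living in an object: its own and those of the objects wrapped inside it. -/
def Platform.ids (P : Platform C) (o : Obj C) : Finset C.ObjID :=
  insert o.id (P.wrapped o.data)

def Platform.outIds (P : Platform C) (x : OutObj C) : Finset C.ObjID :=
  if x.deleted then {x.id} else insert x.id (P.wrapped x.data)

/-- No identifier occurs twice in the listed objects. -/
def Platform.Separated (P : Platform C) (l : List (Obj C)) : Prop :=
  l.Pairwise (fun a b => Disjoint (P.ids a) (P.ids b)) ∧ ∀ o ∈ l, o.id ∉ P.wrapped o.data

/-- The mutable inputs `l` are legitimate inputs of `tx`: no identifier occurs twice in them, and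
none of the identifiers that `tx` itself would create is already in use in them. -/
def Platform.ProperInputs (P : Platform C) (tx : Tx C) (l : List (Obj C)) : Prop :=
  P.Separated l ∧ ∀ o ∈ l, ∀ k, P.newId (P.digest tx) k ∉ P.ids o

/-- The idealised guarantees of the platform: hash functions have no collisions, and the type
system of the virtual machine neither clones identifiers nor makes an identifier appear that is
not in a mutable input (possibly wrapped) and not freshly derived from the transaction digest. -/
structure Platform.Sound (P : Platform C) : Prop where
  digest_injective : Function.Injective P.digest
  newId_injective : ∀ d d' k k', P.newId d k = P.newId d' k' → d = d' ∧ k = k'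
  ids_from_inputs : ∀ tx o r s, P.ProperInputs tx (o ++ s) →
    ∀ x ∈ (P.run tx o r s).out, ∀ i ∈ P.outIds x,
      (∃ y ∈ o ++ s, i ∈ P.ids y) ∨ ∃ k, i = P.newId (P.digest tx) k
  no_clone : ∀ tx o r s, P.ProperInputs tx (o ++ s) →
    (P.run tx o r s).out.Pairwise (fun a b => Disjoint (P.outIds a) (P.outIds b)) ∧
      ∀ x ∈ (P.run tx o r s).out, x.deleted = false → x.id ∉ P.wrapped x.data

/-! ## The object store and the execution of a certificate -/

/-- The object store holds the latest version of each object. -/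
abbrev ObjDB (C : Sorts.{u}) := C.ObjID → Option (Obj C)

/-- The live entries of the store, i.e. those that are not tombstones. -/
def ObjDB.live (db : ObjDB C) : ObjDB C := fun i => (db i).filter (fun o => o.version != 0)

def ObjDB.loadOwned (db : ObjDB C) (tx : Tx C) : Option (List (Obj C)) :=
  tx.inputs.mapM (fun k => (db.live k.1).filter (fun o => o.version == k.2))

def ObjDB.loadReadonly (db : ObjDB C) (tx : Tx C) : Option (List (Obj C)) :=
  tx.readonly.mapM (fun i => (db.live i).filter (fun o => o.owner.isImmutable))

def ObjDB.loadShared (db : ObjDB C) (tx : Tx C) : Option (List (Obj C)) :=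
  tx.shared.mapM (fun p => (db.live p.1).filter (fun o => o.owner.isSharedFrom p.2))

/-- Authorisation of a transaction, given its loaded owned inputs: gas is paid by an owned input,
no mutable input is repeated, every owned input is owned by the sender or is a child of another
mutable input, the user's signature verifies and there is enough gas. -/
def TxValid (P : Platform C) (tx : Tx C) (objs : List (Obj C)) : Prop :=
  tx.gas ∈ tx.inputs ∧
  (tx.inputs.map Prod.fst ++ tx.shared.map Prod.fst).Nodup ∧
  (∀ o ∈ objs, match o.owner with
    | .address a => a = tx.sender
    | .object p => p ∈ tx.inputs.map Prod.fst ++ tx.shared.map Prod.fst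
    | .shared _ => False
    | .immutable => False) ∧
  P.admissible tx objs

/-- Effects of an executed transaction. -/
structure Effects (C : Sorts.{u}) : Type u where
  tx : C.Digest
  /-- digests of the transactions that created the input objects -/
  deps : List C.Digest
  success : Bool
  outputs : List (ObjKey C)
  summary : C.Summary

/-- What a validator writes down about the execution of a certificate. -/
structure Record (C : Sorts.{u}) : Type u where
  cert : Cert C
  consumed : List (Obj C)
  produced : List (Obj C)
  effects : Effects C

/-- One plus the highest version among the given objects. -/
def lamport (l : List (Obj C)) : Version := 1 + (l.map Obj.version).foldr max 0

def OutObj.stamp (v : Version) (d : C.Digest) (x : OutObj C) : Obj C :=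
  { id := x.id, version := if x.deleted then 0 else v, owner := x.owner, data := x.data,
    lastTx := some d }

/-- Shared locks: the version assigned to a shared input of a transaction. -/
abbrev SharedLock (C : Sorts.{u}) := C.Digest → C.ObjID → Option Version

/-- Load the inputs of a certificate, check the shared locks, and run the transaction. `none` if
an input is missing or a shared input is not at the version locked for the transaction. -/
def execute (P : Platform C) (lock : SharedLock C) (db : ObjDB C) (c : Cert C) :
    Option (Record C) :=
  match db.loadOwned c.tx, db.loadReadonly c.tx, db.loadShared c.tx with
  | some o, some r, some s =>
    let d := P.digest c.tx
    if s.all (fun x => lock d x.id == some x.version) then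
      let res := P.run c.tx o r s
      let produced := res.out.map (OutObj.stamp (lamport (o ++ s)) d)
      some
        { cert := c
          consumed := o ++ s
          produced := produced
          effects :=
            { tx := d
              deps := (o ++ r ++ s).filterMap Obj.lastTx
              success := res.success
              outputs := produced.map Obj.key
              summary := res.summary } }
    else none
  | _, _, _ => none

/-- Persist an execution: mutable inputs are consumed, outputs (and tombstones) are written. -/
def ObjDB.apply (db : ObjDB C) (r : Record C) : ObjDB C := fun i =>
  match r.produced.find? (fun o => o.id == i) with
  | some o => some o
  | none => if r.consumed.any (fun o => o.id == i) then none else db i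

/-- Roll back an execution: outputs are removed, consumed inputs are restored. -/
def ObjDB.undo (db : ObjDB C) (r : Record C) : ObjDB C := fun i =>
  match r.consumed.find? (fun o => o.id == i) with
  | some o => some o
  | none => if r.produced.any (fun o => o.id == i) then none else db i

/-- The certificate map. -/
abbrev CertMap (C : Sorts.{u}) := C.Digest → Option (Cert C × Effects C)

def CertMap.add (ct : CertMap C) (r : Record C) : CertMap C :=
  Function.update ct r.effects.tx (some (r.cert, r.effects))

def CertMap.remove (ct : CertMap C) (r : Record C) : CertMap C :=
  Function.update ct r.effects.tx none

/-! ## Committees, faults, and the reconfiguration contract -/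

/-- What consensus orders: certificates and calls of the reconfiguration contract. -/
inductive Item (C : Sorts.{u}) : Type u where
  | cert (c : Cert C)
  | ready (p : C.Val)
  | endOfEpoch (p : C.Val)
  | handover (p : C.Val)

def Item.cert? : Item C → Option (Cert C)
  | .cert c => some c
  | _ => none

abbrev Commit (C : Sorts.{u}) := List (Item C)

structure Config (C : Sorts.{u}) : Type u where
  committee : ℕ → Finset C.Val
  stake : ℕ → C.Val → ℕ
  /-- the validators corrupted in an epoch -/
  faulty : ℕ → Set C.Val
  genesis : ObjDB C
  /-- number of checkpoints of an epoch after which its end may be initiated -/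
  minCheckpoints : ℕ → ℕ
  /-- the deterministic rule that decides, given the commits of the epoch so far, whether the
  last of them closes a checkpoint -/
  closesCheckpoint : List (Commit C) → Bool

def Config.stakeOf (cfg : Config C) (e : ℕ) (Q : Finset C.Val) : ℕ := ∑ v ∈ Q, cfg.stake e v

/-- `Q` consists of committee members holding more than two thirds of the stake; with `3 f + 1`
validators of stake one this means at least `2 f + 1` validators. -/
def Config.IsQuorum (cfg : Config C) (e : ℕ) (Q : Finset C.Val) : Prop :=
  Q ⊆ cfg.committee e ∧ 2 * cfg.stakeOf e (cfg.committee e) < 3 * cfg.stakeOf e Q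

instance (cfg : Config C) (e : ℕ) (Q : Finset C.Val) : Decidable (cfg.IsQuorum e Q) :=
  inferInstanceAs (Decidable (_ ∧ _))

/-- In every epoch the faulty committee members hold less than one third of the stake. -/
def Config.BFT (cfg : Config C) : Prop :=
  ∀ e, ∀ B ⊆ cfg.committee e, (∀ v ∈ B, v ∈ cfg.faulty e) →
    3 * cfg.stakeOf e B < cfg.stakeOf e (cfg.committee e)

/-- `v` is a correct validator of epoch `e`. -/
def Config.Correct (cfg : Config C) (e : ℕ) (v : C.Val) : Prop :=
  v ∈ cfg.committee e ∧ v ∉ cfg.faulty e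

/-- The genesis store is well formed, and its identifiers do not collide with derived ones. -/
structure Config.GenesisOK (P : Platform C) (cfg : Config C) : Prop where
  id_eq : ∀ i o, cfg.genesis i = some o → o.id = i
  version_pos : ∀ i o, cfg.genesis i = some o → 1 ≤ o.version
  lastTx_none : ∀ i o, cfg.genesis i = some o → o.lastTx = none
  disjoint : ∀ i j o o', cfg.genesis i = some o → cfg.genesis j = some o' → i ≠ j →
    Disjoint (P.ids o) (P.ids o')
  not_self_wrapped : ∀ i o, cfg.genesis i = some o → o.id ∉ P.wrapped o.data
  not_derived : ∀ i o, cfg.genesis i = some o → ∀ d k, P.newId d k ∉ P.ids o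

inductive Phase where
  | register
  | ready
  | endOfEpoch
  | handover
  | done
  deriving DecidableEq

/-- In the first two phases validators sign transactions and accept certificates from clients. -/
def Phase.isOpen : Phase → Bool
  | .register => true
  | .ready => true
  | _ => false

structure Contract (C : Sorts.{u}) : Type u where
  phase : Phase
  /-- the validators counted so far in the current phase -/
  votes : Finset C.Val
  epochEdge : ℕ

def Contract.fresh : Contract C := { phase := .register, votes := ∅, epochEdge := 0 }

/-- Effect of one ordered item on the contract of epoch `e`, when `seq` checkpoints of the epoch
have been formed. -/
def Contract.step (cfg : Config C) (e seq : ℕ) (k : Contract C) : Item C → Contract C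
  | .cert _ => k
  | .ready p =>
    let phase := if k.phase = .register ∧ cfg.minCheckpoints e ≤ seq then .ready else k.phase
    if phase = .ready then
      let votes := if p ∈ cfg.committee (e + 1) then insert p k.votes else k.votes
      if cfg.IsQuorum (e + 1) votes then { k with phase := .endOfEpoch, votes := ∅ }
      else { k with phase := .ready, votes := votes }
    else k
  | .endOfEpoch p =>
    if k.phase = .endOfEpoch then
      let votes := if p ∈ cfg.committee e then insert p k.votes else k.votes
      if cfg.IsQuorum e votes then { phase := .handover, votes := ∅, epochEdge := seq }
      else { k with votes := votes }
    else k
  | .handover _ =>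
    if k.phase = .handover ∧ k.epochEdge + 1 ≤ seq then { k with phase := .done } else k

/-! ## Processing the consensus output: shared locks and checkpoints -/

/-- What a node derives from the sequence of commits of an epoch. -/
structure SeqState (C : Sorts.{u}) : Type u where
  /-- the commits processed so far -/
  history : List (Commit C)
  nextShared : C.ObjID → Option Version
  sharedLock : SharedLock C
  /-- the sequenced certificates, one (the first) per transaction -/
  sequenced : List (Cert C)
  /-- certificates in the commits since the last commit that closes a checkpoint -/
  segment : List (Cert C)
  /-- closed segments whose checkpoint is still waiting for missing dependencies -/
  waiting : List (List (Cert C))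
  /-- the checkpoints formed so far -/
  checkpoints : List (List (Record C))
  /-- the object store resulting from the transactions in the checkpoints -/
  checkpointDB : ObjDB C
  contract : Contract C

def SeqState.fresh (db : ObjDB C) (next : C.ObjID → Option Version) : SeqState C :=
  { history := [], nextShared := next, sharedLock := fun _ _ => none, sequenced := [],
    segment := [], waiting := [], checkpoints := [], checkpointDB := db, contract := .fresh }

/-- Digests of all transactions included in checkpoints of the epoch. -/
def SeqState.included (st : SeqState C) : List C.Digest :=
  st.checkpoints.flatten.map (fun r => r.effects.tx)

/-- `tx` has been sequenced by consensus. -/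
def SeqState.Sequenced (st : SeqState C) (tx : Tx C) : Prop := ∃ c ∈ st.sequenced, c.tx = tx

def SeqState.sharedLocksExist (P : Platform C) (st : SeqState C) (tx : Tx C) : Bool :=
  tx.shared.all (fun p => (st.sharedLock (P.digest tx) p.1).isSome)

/-- The version that the next transaction using a shared object gets. -/
def SeqState.nextVersion (st : SeqState C) (p : C.ObjID × Version) : Version :=
  (st.nextShared p.1).getD p.2

def SeqState.writeSharedLocks (P : Platform C) (tx : Tx C) (v : Version) (st : SeqState C) :
    SeqState C :=
  tx.shared.foldl (fun s p =>
    { s with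
      sharedLock := Function.update s.sharedLock (P.digest tx)
        (Function.update (s.sharedLock (P.digest tx)) p.1 (some (s.nextVersion p)))
      nextShared := Function.update s.nextShared p.1 (some (v + 1)) }) st

def SeqState.assignSharedLocks (P : Platform C) (st : SeqState C) (tx : Tx C) : SeqState C :=
  if st.sharedLocksExist P tx then st
  else
    let vo := (tx.inputs.map Prod.snd).foldr max 1
    let vs := (tx.shared.map st.nextVersion).foldr max 1
    st.writeSharedLocks P tx (max vo vs)

/-- Process one sequenced certificate. -/
def SeqState.receive (P : Platform C) (st : SeqState C) (c : Cert C) : SeqState C :=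
  let st := st.assignSharedLocks P c.tx
  { st with
    segment := st.segment ++ [c]
    sequenced :=
      if st.sequenced.any (fun c' => P.digest c'.tx == P.digest c.tx) then st.sequenced
      else st.sequenced ++ [c] }

/-- Execute pending certificates, always the first one in the list whose inputs are available,
until none is left that can be executed (or the fuel `n` is used up). -/
def executeReady (P : Platform C) (lock : SharedLock C) :
    ℕ → ObjDB C → List (Cert C) → List (Record C)
  | 0, _, _ => []
  | n + 1, db, pending =>
    match pending.findSome? (execute P lock db) with
    | none => []
    | some r => r :: executeReady P lock n (db.apply r)
        (pending.filter (fun c => P.digest c.tx != r.effects.tx))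

/-- The records in the list that are among the targets or are, directly or indirectly, among the
dependencies of the targets; their order is kept. -/
def causalPast (targets : List C.Digest) (l : List (Record C)) : List (Record C) :=
  (l.foldr (fun r (acc : List (Record C) × List C.Digest) =>
    if r.effects.tx ∈ acc.2 then (r :: acc.1, r.effects.deps ++ acc.2) else acc)
    ([], targets)).1

/-- Form the checkpoint of the first waiting segment, if all transactions that are needed to make
it causally complete have been sequenced. -/
def SeqState.formCheckpoint (P : Platform C) (st : SeqState C) : Option (SeqState C) :=
  match st.waiting with
  | [] => none
  | seg :: rest =>
    let pending := st.sequenced.filter (fun c => P.digest c.tx ∉ st.included)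
    let recs := executeReady P st.sharedLock pending.length st.checkpointDB pending
    let targets := (seg.map (fun c => P.digest c.tx)).filter (fun d => d ∉ st.included)
    if targets.all (fun d => recs.any (fun r => r.effects.tx == d)) then
      let cp := causalPast targets recs
      some { st with
        waiting := rest
        checkpoints := st.checkpoints ++ [cp]
        checkpointDB := cp.foldl ObjDB.apply st.checkpointDB }
    else none

def SeqState.formCheckpoints (P : Platform C) : ℕ → SeqState C → SeqState C
  | 0, st => st
  | n + 1, st =>
    match st.formCheckpoint P with
    | none => st
    | some st' => SeqState.formCheckpoints P n st'

/-- Process one commit of epoch `e`. Commits after the handover are ignored. -/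
def SeqState.commit (P : Platform C) (cfg : Config C) (e : ℕ) (st : SeqState C)
    (items : Commit C) : SeqState C :=
  if st.contract.phase = .done then st
  else
    let contract := items.foldl (Contract.step cfg e st.checkpoints.length) st.contract
    let st1 := (items.filterMap Item.cert?).foldl (SeqState.receive P)
      { st with history := st.history ++ [items], contract := contract }
    let st2 := if cfg.closesCheckpoint st1.history then
        { st1 with waiting := st1.waiting ++ [st1.segment], segment := [] }
      else st1
    st2.formCheckpoints P st2.waiting.length

/-! ## Validators -/

/-- The stores that survive an epoch change. -/
structure Persistent (C : Sorts.{u}) : Type u where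
  objDB : ObjDB C
  ct : CertMap C
  nextShared : C.ObjID → Option Version

/-- The local state of a correct validator within an epoch. The stores for shared locks and next
shared locks are components of `seq`. -/
structure Local (C : Sorts.{u}) : Type u where
  objDB : ObjDB C
  ct : CertMap C
  /-- the transaction signed for an owned object key, if any -/
  ownedLock : ObjKey C → Option (Tx C)
  seq : SeqState C
  /-- executions of the current epoch, the latest first -/
  journal : List (Record C)
  /-- the validator has called the end-of-epoch function of the contract -/
  closing : Bool

/-- State in which a validator enters an epoch: all locks are dropped. -/
def Persistent.enter (S : Persistent C) : Local C :=
  { objDB := S.objDB, ct := S.ct, ownedLock := fun _ => none,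
    seq := .fresh S.objDB S.nextShared, journal := [], closing := false }

/-- Checks made by a validator before signing a transaction. -/
def Local.Signable (P : Platform C) (L : Local C) (tx : Tx C) : Prop :=
  (∃ o, L.objDB.loadOwned tx = some o ∧ TxValid P tx o) ∧
  (L.objDB.loadReadonly tx).isSome ∧
  (L.objDB.loadShared tx).isSome ∧
  ∀ k ∈ tx.inputs, L.ownedLock k = none ∨ L.ownedLock k = some tx

def Local.lock (L : Local C) (tx : Tx C) : Local C :=
  { L with ownedLock := fun k => if k ∈ tx.inputs then some tx else L.ownedLock k }

/-- Persist an execution. Owned outputs become lockable; if the execution failed, the locks of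
the owned inputs are released. -/
def Local.persist (L : Local C) (r : Record C) : Local C :=
  { L with
    objDB := L.objDB.apply r
    ct := L.ct.add r
    ownedLock := fun k =>
      if r.produced.any (fun o => o.owner.isOwned && o.key == k) then none
      else if !r.effects.success && decide (k ∈ r.cert.tx.inputs) then none
      else L.ownedLock k
    journal := r :: L.journal }

/-- Roll back, the latest first, the executions of the epoch that are in no checkpoint. -/
def Local.rollback (L : Local C) : ObjDB C × CertMap C :=
  L.journal.foldl (fun s r =>
    if r.effects.tx ∈ L.seq.included then s else (s.1.undo r, s.2.remove r)) (L.objDB, L.ct)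

/-- The stores carried over to the next epoch: uncheckpointed executions are rolled back and
tombstones are cleared. -/
def Local.carryOver (L : Local C) : Persistent C :=
  { objDB := L.rollback.1.live, ct := L.rollback.2, nextShared := L.seq.nextShared }

/-- The stores of a full node at the start of epoch `e`, obtained from genesis by processing the
consensus output of all earlier epochs and executing the transactions in the checkpoints; `none`
as long as one of these epochs has not ended. -/
def fullNode (P : Platform C) (cfg : Config C) (log : ℕ → List (Commit C)) :
    ℕ → Option (Persistent C)
  | 0 => some { objDB := cfg.genesis, ct := fun _ => none, nextShared := fun _ => none }
  | e + 1 =>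
    match fullNode P cfg log e with
    | none => none
    | some S =>
      let st := (log e).foldl (SeqState.commit P cfg e) (.fresh S.objDB S.nextShared)
      if st.contract.phase = .done then
        some
          { objDB := st.checkpointDB.live
            ct := st.checkpoints.flatten.foldl CertMap.add S.ct
            nextShared := st.nextShared }
      else none

/-! ## Runs of the system -/

/-- Global state. `loc v e` is the local state of the correct validator `v` in epoch `e`, `none`
before `v` has entered the epoch; `log e` is the consensus output of epoch `e` so far; `signed`
holds the transaction signatures issued by correct validators. -/
structure Global (C : Sorts.{u}) : Type u where
  loc : C.Val → ℕ → Option (Local C)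
  log : ℕ → List (Commit C)
  signed : C.Val → ℕ → Tx C → Prop

/-- The certificate carries signatures of a quorum for its epoch. Signatures of correct validators
cannot be forged, faulty ones sign anything. -/
def Global.Genuine (cfg : Config C) (g : Global C) (c : Cert C) : Prop :=
  cfg.IsQuorum c.epoch c.signers ∧
  ∀ p ∈ c.signers, p ∈ cfg.faulty c.epoch ∨ g.signed p c.epoch c.tx

/-- The item can be output by the consensus of epoch `e`. -/
def Global.Authentic (cfg : Config C) (g : Global C) (e : ℕ) : Item C → Prop
  | .cert c => c.epoch = e ∧ g.Genuine cfg c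
  | .endOfEpoch p => cfg.Correct e p → ∃ L, g.loc p e = some L ∧ L.closing = true
  | .ready _ => True
  | .handover _ => True

def Global.setLoc (g : Global C) (v : C.Val) (e : ℕ) (L : Local C) : Global C :=
  { g with loc := Function.update g.loc v (Function.update (g.loc v) e (some L)) }

/-- `v` is a correct validator that currently operates in epoch `e`, with local state `L`. -/
def Global.Active (cfg : Config C) (g : Global C) (v : C.Val) (e : ℕ) (L : Local C) : Prop :=
  cfg.Correct e v ∧ g.loc v e = some L ∧ g.loc v (e + 1) = none

/-- The atomic steps. Scheduling, message delivery, users and faulty validators are adversarial. -/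
inductive Step (P : Platform C) (cfg : Config C) : Global C → Global C → Prop where
  /-- a validator checks, locks and signs a transaction received from a user -/
  | processTx {g : Global C} (v : C.Val) (e : ℕ) (L : Local C) (tx : Tx C)
      (active : g.Active cfg v e L)
      (not_paused : L.seq.contract.phase.isOpen)
      (checks : L.Signable P tx) :
      Step P cfg g
        { g.setLoc v e (L.lock tx) with
          signed := fun w k t => g.signed w k t ∨ (w = v ∧ k = e ∧ t = tx) }
  /-- a validator executes a certificate of the current epoch; near the end of the epoch only
  certificates that have been sequenced -/
  | processCert {g : Global C} (v : C.Val) (e : ℕ) (L : Local C) (c : Cert C) (r : Record C)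
      (active : g.Active cfg v e L)
      (epoch : c.epoch = e)
      (genuine : g.Genuine cfg c)
      (accepted : L.seq.contract.phase.isOpen ∨ L.seq.Sequenced c.tx)
      (executed : execute P L.seq.sharedLock L.objDB c = some r) :
      Step P cfg g (g.setLoc v e (L.persist r))
  /-- consensus outputs a further commit -/
  | consensus {g : Global C} (e : ℕ) (items : Commit C)
      (authentic : ∀ x ∈ items, g.Authentic cfg e x) :
      Step P cfg g { g with log := Function.update g.log e (g.log e ++ [items]) }
  /-- a validator processes the next commit -/
  | processCommit {g : Global C} (v : C.Val) (e : ℕ) (L : Local C) (items : Commit C)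
      (active : g.Active cfg v e L)
      (next : (g.log e)[L.seq.history.length]? = some items) :
      Step P cfg g (g.setLoc v e { L with seq := L.seq.commit P cfg e items })
  /-- a validator calls the end-of-epoch function, once all transactions it has executed in the
  epoch have been sequenced -/
  | endOfEpoch {g : Global C} (v : C.Val) (e : ℕ) (L : Local C)
      (active : g.Active cfg v e L)
      (phase : L.seq.contract.phase = .endOfEpoch)
      (all_sequenced : ∀ r ∈ L.journal, L.seq.Sequenced r.cert.tx) :
      Step P cfg g (g.setLoc v e { L with closing := true })
  /-- after the handover, a validator that stays in the committee enters the next epoch, once it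
  has executed all transactions in the checkpoints -/
  | handover {g : Global C} (v : C.Val) (e : ℕ) (L : Local C)
      (active : g.Active cfg v e L)
      (next_committee : cfg.Correct (e + 1) v)
      (phase : L.seq.contract.phase = .done)
      (all_executed : ∀ d ∈ L.seq.included, ∃ r ∈ L.journal, r.effects.tx = d) :
      Step P cfg g (g.setLoc v (e + 1) L.carryOver.enter)
  /-- a validator that was not a correct validator in the previous epoch enters an epoch with the
  state of a full node -/
  | join {g : Global C} (v : C.Val) (e : ℕ) (S : Persistent C)
      (next_committee : cfg.Correct (e + 1) v)
      (new : ¬ cfg.Correct e v)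
      (not_entered : g.loc v (e + 1) = none)
      (synchronised : fullNode P cfg g.log (e + 1) = some S) :
      Step P cfg g (g.setLoc v (e + 1) S.enter)

/-- The genesis stores. -/
def Config.genesisStores (cfg : Config C) : Persistent C :=
  { objDB := cfg.genesis, ct := fun _ => none, nextShared := fun _ => none }

/-- Initially exactly the correct validators of epoch `0` are running, in the genesis state. -/
structure Global.Initial (cfg : Config C) (g : Global C) : Prop where
  running : ∀ v, cfg.Correct 0 v → g.loc v 0 = some cfg.genesisStores.enter
  not_running : ∀ v e, ¬ (e = 0 ∧ cfg.Correct 0 v) → g.loc v e = none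
  log_empty : ∀ e, g.log e = []
  nothing_signed : ∀ v e tx, ¬ g.signed v e tx

/-- A run: an infinite sequence of global states; repeating a state is allowed, so that finite
runs are included. -/
def IsRun (P : Platform C) (cfg : Config C) (σ : ℕ → Global C) : Prop :=
  (σ 0).Initial cfg ∧ ∀ t, σ (t + 1) = σ t ∨ Step P cfg (σ t) (σ (t + 1))

/-- The five stores of a validator. Two certificates for the same transaction and epoch are
regarded as the same, whoever signed them. -/
structure Stores (C : Sorts.{u}) : Type u where
  objDB : ObjDB C
  ownedLock : ObjKey C → Option (Tx C)
  sharedLock : SharedLock C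
  nextShared : C.ObjID → Option Version
  ct : C.Digest → Option ((Tx C × ℕ) × Effects C)

def Local.stores (L : Local C) : Stores C :=
  { objDB := L.objDB
    ownedLock := L.ownedLock
    sharedLock := L.seq.sharedLock
    nextShared := L.seq.nextShared
    ct := fun d => (L.ct d).map (fun x => ((x.1.tx, x.1.epoch), x.2)) }

/-- `S` is the content of the stores of `v` at the moment when `v` enters epoch `e`. -/
def StartsEpochWith (σ : ℕ → Global C) (v : C.Val) (e : ℕ) (S : Stores C) : Prop :=
  ∃ t L, (σ t).loc v e = some L ∧ (∀ t' < t, (σ t').loc v e = none) ∧ S = L.stores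

end Lutris

namespace Lutris

variable {C : Sorts.{u}}

/-! ## Loading inputs -/

/-! Fix an epoch and suppose that all its validators enter it with the same stores, up to the
signers of certificates. It suffices that they carry over to the next epoch the stores of a full
node; the theorem follows by induction on the epoch (`StartsWith.next`). Within the epoch,
validators execute different sets of transactions in different orders, so their stores cannot be
compared directly. They are compared through one list of successive executions from the entry
stores, which contains every execution of a correct validator and every checkpointed one. This
common trace exists only in the proof and grows along the run (`EpochInv`).

One trace suffices because executions are confluent. Two different certified transactions enabled in
the same store never consume the same object. For owned inputs, two quorums share a correct signer,
whose owned locks forbid it to sign both (`EpochInv.step_sign`). For shared inputs, no version is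
ever assigned to two transactions (`LockInv`). Read-only objects are not consumed at all. Hence such
executions commute (`Enabled.diamond`, `Enabled.apply_comm`), and an execution that is possible
after some part of the trace either occurs in the trace or can be appended to it (`Valid.absorb`).

Locks are released during the epoch, so a used object key must never come back. Outputs get versions
above all consumed ones, and identifiers are neither cloned nor reinvented; therefore a consumed key
stays dead (`Dead`, `Good`), even if its object is wrapped, unwrapped or deleted later. It also
follows that a key determines the object (`Valid.hist_unique`). This transfers the ownership seen by
a signer to an executing validator, which does not check it.

A checkpoint is closed under dependencies, so the checkpointed executions form a trace by themselves
(`Valid.causalPast`). A validator that has executed all of them can be regarded as having executed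
them first and its other transactions afterwards (`Valid.residual`). Undoing the others, latest
first, therefore yields exactly the checkpointed store (`EpochInv.carryOver_same`). The shared-lock
tables and the checkpoints are functions of the commits alone, and no longer change after the
handover. -/

theorem mapM_option_eq_some_iff {α β : Type*} {f : α → Option β} {l : List α} {o : List β} :
    l.mapM f = some o ↔ List.Forall₂ (fun a b => f a = some b) l o := by
  induction l generalizing o with
  | nil => cases o <;> simp [List.mapM_nil, pure]
  | cons a l ih =>
    simp only [List.mapM_cons, Option.bind_eq_bind, Option.bind_eq_some_iff, pure,
      Option.some.injEq]
    constructor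
    · rintro ⟨b, hb, t, ht, rfl⟩
      exact .cons hb (ih.1 ht)
    · rintro (_ | ⟨hb, ht⟩)
      exact ⟨_, hb, _, ih.2 ht, rfl⟩

theorem mapM_option_congr {α β : Type*} {f g : α → Option β} {l : List α}
    (h : ∀ a ∈ l, f a = g a) : l.mapM f = l.mapM g := by
  induction l with
  | nil => rfl
  | cons a l ih =>
    rw [List.mapM_cons, List.mapM_cons, h a (by simp), ih fun b hb => h b (by simp [hb])]

theorem forall₂_exists_of_mem_left {α β : Type*} {R : α → β → Prop} {l : List α} {m : List β}
    (h : List.Forall₂ R l m) {a : α} (ha : a ∈ l) : ∃ b ∈ m, R a b := by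
  induction h with
  | nil => simp at ha
  | cons hR _ ih =>
    rcases List.mem_cons.1 ha with rfl | ha
    · exact ⟨_, by simp, hR⟩
    · obtain ⟨b, hb, h⟩ := ih ha
      exact ⟨b, by simp [hb], h⟩

theorem forall₂_exists_of_mem_right {α β : Type*} {R : α → β → Prop} {l : List α} {m : List β}
    (h : List.Forall₂ R l m) {b : β} (hb : b ∈ m) : ∃ a ∈ l, R a b :=
  forall₂_exists_of_mem_left (List.Forall₂.flip h) hb

theorem forall₂_map_eq {α β γ : Type*} {R : α → β → Prop} {f : α → γ} {g : β → γ} {l : List α}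
    {m : List β} (h : List.Forall₂ R l m) (hR : ∀ a b, R a b → g b = f a) :
    m.map g = l.map f := by
  induction h with
  | nil => rfl
  | cons h _ ih => simp [hR _ _ h, ih]

theorem ObjDB.live_eq_some_iff {db : ObjDB C} {i : C.ObjID} {o : Obj C} :
    db.live i = some o ↔ db i = some o ∧ o.version ≠ 0 := by
  simp [ObjDB.live, Option.filter_eq_some_iff]

/-- Identifiers of the owned and shared inputs. -/
def Tx.mutIds (tx : Tx C) : List C.ObjID := tx.inputs.map Prod.fst ++ tx.shared.map Prod.fst

/-- The record of an execution on the given owned, read-only and shared inputs. -/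
def mkRecord (P : Platform C) (c : Cert C) (o r s : List (Obj C)) : Record C :=
  { cert := c
    consumed := o ++ s
    produced := (P.run c.tx o r s).out.map (OutObj.stamp (lamport (o ++ s)) (P.digest c.tx))
    effects :=
      { tx := P.digest c.tx
        deps := (o ++ r ++ s).filterMap Obj.lastTx
        success := (P.run c.tx o r s).success
        outputs := ((P.run c.tx o r s).out.map
          (OutObj.stamp (lamport (o ++ s)) (P.digest c.tx))).map Obj.key
        summary := (P.run c.tx o r s).summary } }

theorem execute_eq_some_iff {P : Platform C} {lock : SharedLock C} {db : ObjDB C} {c : Cert C}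
    {rec : Record C} :
    execute P lock db c = some rec ↔ ∃ o r s, db.loadOwned c.tx = some o ∧
      db.loadReadonly c.tx = some r ∧ db.loadShared c.tx = some s ∧
      (∀ x ∈ s, lock (P.digest c.tx) x.id = some x.version) ∧ rec = mkRecord P c o r s := by
  unfold execute
  cases h1 : db.loadOwned c.tx with
  | none => simp
  | some o =>
  cases h2 : db.loadReadonly c.tx with
  | none => simp
  | some r =>
  cases h3 : db.loadShared c.tx with
  | none => simp
  | some s =>
  simp only [List.all_eq_true, beq_iff_eq]
  constructor
  · intro h
    split at h
    · next hs => exact ⟨o, r, s, rfl, rfl, rfl, hs, (Option.some.inj h).symm⟩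
    · cases h
  · rintro ⟨o', r', s', h1, h2, h3, hs, rfl⟩
    cases h1; cases h2; cases h3
    rw [if_pos hs]; rfl

/-- Which objects an execution loads. -/
structure Loads (db : ObjDB C) (tx : Tx C) (o r s : List (Obj C)) : Prop where
  owned : List.Forall₂ (fun k x => db k.1 = some x ∧ x.version ≠ 0 ∧ x.version = k.2) tx.inputs o
  readonly : List.Forall₂ (fun i x => db i = some x ∧ x.version ≠ 0 ∧ x.owner.isImmutable = true)
    tx.readonly r
  shared : List.Forall₂ (fun p x => db p.1 = some x ∧ x.version ≠ 0 ∧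
    x.owner.isSharedFrom p.2 = true) tx.shared s

theorem loadOwned_iff {db : ObjDB C} {tx : Tx C} {o : List (Obj C)} :
    db.loadOwned tx = some o ↔
    List.Forall₂ (fun k x => db k.1 = some x ∧ x.version ≠ 0 ∧ x.version = k.2) tx.inputs o := by
  simp [ObjDB.loadOwned, mapM_option_eq_some_iff, Option.filter_eq_some_iff,
    ObjDB.live_eq_some_iff, and_assoc]

theorem loads_iff {db : ObjDB C} {tx : Tx C} {o r s : List (Obj C)} :
    Loads db tx o r s ↔ db.loadOwned tx = some o ∧ db.loadReadonly tx = some r ∧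
      db.loadShared tx = some s := by
  rw [loadOwned_iff]
  simp only [ObjDB.loadReadonly, ObjDB.loadShared, mapM_option_eq_some_iff,
    Option.filter_eq_some_iff, ObjDB.live_eq_some_iff, and_assoc]
  exact ⟨fun h => ⟨h.1, h.2, h.3⟩, fun h => ⟨h.1, h.2.1, h.2.2⟩⟩

theorem execute_iff_loads {P : Platform C} {lock : SharedLock C} {db : ObjDB C} {c : Cert C}
    {rec : Record C} :
    execute P lock db c = some rec ↔ ∃ o r s, Loads db c.tx o r s ∧
      (∀ x ∈ s, lock (P.digest c.tx) x.id = some x.version) ∧ rec = mkRecord P c o r s := by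
  simp only [execute_eq_some_iff, loads_iff, and_assoc]

/-- An execution reads the store only at its inputs. Commutation of executions reduces to this
locality. -/
theorem execute_congr {P : Platform C} {lock : SharedLock C} {db db' : ObjDB C} {c : Cert C}
    (h : ∀ i ∈ c.tx.mutIds ++ c.tx.readonly, db' i = db i) :
    execute P lock db' c = execute P lock db c := by
  have hl : ∀ i ∈ c.tx.mutIds ++ c.tx.readonly, db'.live i = db.live i := fun i hi => by
    simp [ObjDB.live, h i hi]
  have h1 : db'.loadOwned c.tx = db.loadOwned c.tx := mapM_option_congr fun k hk => by
    rw [hl k.1 (by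
      simp only [Tx.mutIds, List.mem_append, List.mem_map]
      exact .inl (.inl ⟨k, hk, rfl⟩))]
  have h2 : db'.loadReadonly c.tx = db.loadReadonly c.tx := mapM_option_congr fun i hi => by
    rw [hl i (by simp [hi])]
  have h3 : db'.loadShared c.tx = db.loadShared c.tx := mapM_option_congr fun p hp => by
    rw [hl p.1 (by
      simp only [Tx.mutIds, List.mem_append, List.mem_map]
      exact .inl (.inr ⟨p, hp, rfl⟩))]
  simp only [execute, h1, h2, h3]

/-! ## Forgetting who signed -/

/-- The transaction as a certificate without epoch and signatures. -/
def Cert.bare (tx : Tx C) : Cert C := { tx := tx, epoch := 0, signers := ∅ }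

/-- The record without the epoch and signatures of its certificate. -/
def Record.bare (r : Record C) : Record C := { r with cert := Cert.bare r.cert.tx }

/-- Validators may hold different certificates for one transaction. The common trace contains bare
records only, so that equal executions become equal records. -/
theorem execute_bare {P : Platform C} {lock : SharedLock C} {db : ObjDB C} {c : Cert C}
    {r : Record C} (h : execute P lock db c = some r) :
    execute P lock db (Cert.bare c.tx) = some r.bare ∧ r.cert = c := by
  obtain ⟨o, ro, s, hl, hs, rfl⟩ := execute_iff_loads.1 h
  exact ⟨execute_iff_loads.2 ⟨o, ro, s, hl, hs, rfl⟩, rfl⟩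

/-- Shared locks of `a` are also locks of `b`. -/
def LockLe (a b : SharedLock C) : Prop := ∀ d i n, a d i = some n → b d i = some n

/-- Used to regard executions made under the locks of a shorter log as executions under those of a
longer one. -/
theorem execute_mono {P : Platform C} {lock lock' : SharedLock C} (hle : LockLe lock lock')
    {db : ObjDB C} {c : Cert C} {r : Record C} (h : execute P lock db c = some r) :
    execute P lock' db c = some r := by
  obtain ⟨o, ro, s, hl, hs, rfl⟩ := execute_iff_loads.1 h
  exact execute_iff_loads.2 ⟨o, ro, s, hl, fun x hx => hle _ _ _ (hs x hx), rfl⟩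

/-! ## Well-formed stores -/

/-- The identifiers living in a store entry; a tombstone contains only its own. -/
def Platform.entryIds (P : Platform C) (o : Obj C) : Finset C.ObjID :=
  if o.version = 0 then {o.id} else P.ids o

theorem Platform.id_mem_ids (P : Platform C) (o : Obj C) : o.id ∈ P.ids o := by
  simp [Platform.ids]

theorem Platform.id_mem_entryIds (P : Platform C) (o : Obj C) : o.id ∈ P.entryIds o := by
  unfold Platform.entryIds; split <;> simp [P.id_mem_ids]

theorem Platform.entryIds_of_live (P : Platform C) {o : Obj C} (h : o.version ≠ 0) :
    P.entryIds o = P.ids o := by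
  simp [Platform.entryIds, h]

/-- `i` is not among the identifiers derived from digests outside `D`. -/
def Known (P : Platform C) (D : Set C.Digest) (i : C.ObjID) : Prop :=
  ∀ d k, i = P.newId d k → d ∈ D

/-- The object key is in the past: the object has moved on to higher versions or is gone. -/
def Dead (P : Platform C) (D : Set C.Digest) (db : ObjDB C) (k : ObjKey C) : Prop :=
  Known P D k.1 ∧ ∀ i o, db i = some o → o.version ≠ 0 → k.1 ∈ P.ids o → k.2 < o.version

/-- Invariants of an object store in which the transactions with digests in `D` have been
executed. -/
structure Good (P : Platform C) (db : ObjDB C) (D : Set C.Digest) : Prop where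
  id_eq : ∀ {i o}, db i = some o → o.id = i
  disjoint : ∀ {i j o o'}, db i = some o → db j = some o' → i ≠ j →
    Disjoint (P.entryIds o) (P.entryIds o')
  not_self_wrapped : ∀ {i o}, db i = some o → o.version ≠ 0 → o.id ∉ P.wrapped o.data
  known : ∀ {i o}, db i = some o → ∀ j ∈ P.entryIds o, Known P D j
  spent : ∀ tx, P.digest tx ∈ D → ∃ k ∈ tx.inputs, Dead P D db k

theorem Good.index_eq {P : Platform C} {db : ObjDB C} {D : Set C.Digest} (h : Good P db D)
    {i j m : C.ObjID} {o o' : Obj C} (hi : db i = some o) (hj : db j = some o')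
    (hm : m ∈ P.entryIds o) (hm' : m ∈ P.entryIds o') : i = j := by
  by_contra hne
  exact Finset.disjoint_left.1 (h.disjoint hi hj hne) hm hm'

/-- Every clause of `Good` only restricts the entries that are present. Forgetting tombstones does
not free their identifiers, since `Known` refers to executed digests and not to the store. -/
theorem Good.live {P : Platform C} {db : ObjDB C} {D : Set C.Digest} (h : Good P db D) :
    Good P db.live D where
  id_eq hi := h.id_eq (ObjDB.live_eq_some_iff.1 hi).1
  disjoint hi hj := h.disjoint (ObjDB.live_eq_some_iff.1 hi).1 (ObjDB.live_eq_some_iff.1 hj).1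
  not_self_wrapped hi := h.not_self_wrapped (ObjDB.live_eq_some_iff.1 hi).1
  known hi := h.known (ObjDB.live_eq_some_iff.1 hi).1
  spent tx ht := by
    obtain ⟨k, hk, hd⟩ := h.spent tx ht
    exact ⟨k, hk, hd.1, fun i o hi => hd.2 i o (ObjDB.live_eq_some_iff.1 hi).1⟩

theorem Config.GenesisOK.good {P : Platform C} {cfg : Config C} (h : cfg.GenesisOK P) :
    Good P cfg.genesis ∅ where
  id_eq := h.id_eq _ _
  disjoint {i j o o'} hi hj hne := by
    have h1 := h.version_pos i o hi
    have h2 := h.version_pos j o' hj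
    rw [P.entryIds_of_live (Nat.ne_of_gt h1), P.entryIds_of_live (Nat.ne_of_gt h2)]
    exact h.disjoint i j o o' hi hj hne
  not_self_wrapped hi _ := h.not_self_wrapped _ _ hi
  known {i o} hi j hj d k hk := by
    have h1 := h.version_pos i o hi
    rw [P.entryIds_of_live (Nat.ne_of_gt h1)] at hj
    exact absurd (hk ▸ hj) (h.not_derived i o hi d k)
  spent _ ht := ht.elim

theorem le_foldr_max {l : List ℕ} {x b : ℕ} (h : x ∈ l) : x ≤ l.foldr max b := by
  induction l with
  | nil => simp at h
  | cons a l ih =>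
    rcases List.mem_cons.1 h with rfl | h
    · simp
    · simp [ih h]

theorem lt_lamport {l : List (Obj C)} {o : Obj C} (h : o ∈ l) : o.version < lamport l :=
  Nat.lt_one_add_iff.2 (le_foldr_max (List.mem_map_of_mem (f := Obj.version) h))

theorem lamport_ne_zero (l : List (Obj C)) : lamport l ≠ 0 :=
  Nat.ne_of_gt (Nat.lt_add_right _ Nat.one_pos)

/-! ## Executions and their effect on the store -/

def Record.consumedIds (r : Record C) : List C.ObjID := r.consumed.map Obj.id
def Record.producedIds (r : Record C) : List C.ObjID := r.produced.map Obj.id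

/-- What validators check before signing and what does not depend on the store. -/
structure Tx.Legit (tx : Tx C) : Prop where
  gas : tx.gas ∈ tx.inputs
  nodup : tx.mutIds.Nodup

/-- The rules that the certified transactions of an epoch obey: two of them have no owned input
key in common and are never assigned the same version of a shared object. -/
structure Rules (P : Platform C) (lock : SharedLock C) (Q : Tx C → Prop) : Prop where
  sound : P.Sound
  legit : ∀ {tx}, Q tx → tx.Legit
  key_unique : ∀ {tx tx' k}, Q tx → Q tx' → k ∈ tx.inputs → k ∈ tx'.inputs → tx = tx'
  lock_unique : ∀ {d d' i n}, lock d i = some n → lock d' i = some n → d = d'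

/-- In `db`, the certified transaction of the record `r` executes, with result `r`. -/
structure Enabled (P : Platform C) (lock : SharedLock C) (Q : Tx C → Prop) (db : ObjDB C)
    (r : Record C) : Prop where
  exec : execute P lock db (Cert.bare r.cert.tx) = some r
  certified : Q r.cert.tx
  owned : ∀ k ∈ r.cert.tx.inputs, ∀ o, db k.1 = some o → o.owner.isOwned = true

section executions
variable {P : Platform C} {lock : SharedLock C} {Q : Tx C → Prop} {db : ObjDB C}
  {D : Set C.Digest} {r r' : Record C}

theorem Enabled.digest_eq (h : Enabled P lock Q db r) : r.effects.tx = P.digest r.cert.tx := by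
  obtain ⟨o, ro, s, -, -, hr⟩ := execute_iff_loads.1 h.exec
  rw [hr]; rfl

theorem Enabled.congr {db' : ObjDB C} (h : Enabled P lock Q db r)
    (hdb : ∀ i ∈ r.cert.tx.mutIds ++ r.cert.tx.readonly, db' i = db i) :
    Enabled P lock Q db' r where
  exec := by rw [execute_congr (c := Cert.bare r.cert.tx) hdb]; exact h.exec
  certified := h.certified
  owned k hk o ho := by
    refine h.owned k hk o ?_
    rw [← hdb k.1 ?_]
    · exact ho
    · simp only [Tx.mutIds, List.mem_append, List.mem_map]; exact .inl (.inl ⟨k, hk, rfl⟩)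

theorem Enabled.mono {lock' : SharedLock C} {Q' : Tx C → Prop} (hl : LockLe lock lock')
    (hQ : ∀ tx, Q tx → Q' tx) (h : Enabled P lock Q db r) : Enabled P lock' Q' db r where
  exec := execute_mono hl h.exec
  certified := hQ _ h.certified
  owned := h.owned

theorem Enabled.consumedIds_eq (hG : Good P db D) (h : Enabled P lock Q db r) :
    r.consumedIds = r.cert.tx.mutIds := by
  obtain ⟨o, ro, s, hl, -, hr⟩ := execute_iff_loads.1 h.exec
  have h1 := forall₂_map_eq (g := Obj.id) (f := Prod.fst) hl.owned fun a b h => hG.id_eq h.1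
  have h2 := forall₂_map_eq (g := Obj.id) (f := Prod.fst) hl.shared fun a b h => hG.id_eq h.1
  have h3 : r.consumed = o ++ s := by rw [hr]; rfl
  rw [Record.consumedIds, h3, List.map_append, h1, h2]; rfl

theorem Enabled.consumed_in (hG : Good P db D) (h : Enabled P lock Q db r) {x : Obj C}
    (hx : x ∈ r.consumed) : db x.id = some x ∧ x.version ≠ 0 := by
  obtain ⟨o, ro, s, hl, -, hr⟩ := execute_iff_loads.1 h.exec
  rw [hr] at hx
  rcases List.mem_append.1 hx with hx | hx
  · obtain ⟨k, -, hk⟩ := forall₂_exists_of_mem_right hl.owned hx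
    rw [hG.id_eq hk.1]; exact ⟨hk.1, hk.2.1⟩
  · obtain ⟨k, -, hk⟩ := forall₂_exists_of_mem_right hl.shared hx
    rw [hG.id_eq hk.1]; exact ⟨hk.1, hk.2.1⟩

theorem Enabled.input_in (hG : Good P db D) (h : Enabled P lock Q db r) {k : ObjKey C}
    (hk : k ∈ r.cert.tx.inputs) : ∃ x ∈ r.consumed, x.key = k := by
  obtain ⟨o, ro, s, hl, -, hr⟩ := execute_iff_loads.1 h.exec
  obtain ⟨x, hx, h1, -, h2⟩ := forall₂_exists_of_mem_left hl.owned hk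
  refine ⟨x, ?_, Prod.ext (hG.id_eq h1) h2⟩
  rw [hr]; exact List.mem_append_left _ hx

/-- An executed transaction has an owned input whose key is dead, whereas an execution needs exactly
this object live in the store. So a transaction executes at most once, and the identifiers derived
from its digest are unused when it does. -/
theorem Enabled.fresh (hG : Good P db D) (h : Enabled P lock Q db r) :
    r.effects.tx ∉ D := by
  rw [h.digest_eq]
  intro hd
  obtain ⟨k, hk, -, hk'⟩ := hG.spent _ hd
  obtain ⟨x, hx, rfl⟩ := h.input_in hG hk
  obtain ⟨h1, h2⟩ := h.consumed_in hG hx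
  exact lt_irrefl _ (hk' _ _ h1 h2 (P.id_mem_ids x))

/-- Establishes the condition under which the platform gives its guarantees. The derived identifiers
are not in use because the digest is fresh and the store holds `Known` identifiers only. -/
theorem Enabled.proper (R : Rules P lock Q) (hG : Good P db D) (h : Enabled P lock Q db r) :
    P.ProperInputs r.cert.tx r.consumed := by
  have hnd : (r.consumed.map Obj.id).Nodup := by
    have := (R.legit h.certified).nodup
    rwa [← h.consumedIds_eq hG] at this
  refine ⟨⟨?_, fun o ho => hG.not_self_wrapped (h.consumed_in hG ho).1 (h.consumed_in hG ho).2⟩, ?_⟩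
  · rw [List.Nodup, List.pairwise_map] at hnd
    refine hnd.imp_of_mem fun {a b} ha hb hne => ?_
    obtain ⟨h1, h2⟩ := h.consumed_in hG ha
    obtain ⟨h3, h4⟩ := h.consumed_in hG hb
    rw [← P.entryIds_of_live h2, ← P.entryIds_of_live h4]
    exact hG.disjoint h1 h3 hne
  · intro o ho k hk
    obtain ⟨h1, h2⟩ := h.consumed_in hG ho
    rw [← P.entryIds_of_live h2] at hk
    have := hG.known h1 _ hk _ _ rfl
    rw [← h.digest_eq] at this
    exact h.fresh hG this

theorem entryIds_stamp (P : Platform C) {n : ℕ} (hn : n ≠ 0) (d : C.Digest) (x : OutObj C) :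
    P.entryIds (x.stamp n d) = P.outIds x := by
  unfold Platform.entryIds Platform.outIds OutObj.stamp
  cases x.deleted <;> simp [hn, Platform.ids]

theorem Enabled.produced_ids (R : Rules P lock Q) (hG : Good P db D) (h : Enabled P lock Q db r)
    {x : Obj C} (hx : x ∈ r.produced) {i : C.ObjID} (hi : i ∈ P.entryIds x) :
    (∃ y ∈ r.consumed, i ∈ P.entryIds y) ∨ ∃ k, i = P.newId r.effects.tx k := by
  have hp := h.proper R hG
  obtain ⟨o, ro, s, hl, -, hr⟩ := execute_iff_loads.1 h.exec
  have hc : r.consumed = o ++ s := by rw [hr]; rfl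
  rw [hr] at hx
  obtain ⟨z, hz, rfl⟩ := List.mem_map.1 hx
  rw [entryIds_stamp P (lamport_ne_zero _)] at hi
  rw [h.digest_eq]
  refine (R.sound.ids_from_inputs _ o ro s (hc ▸ hp) z hz i hi).imp_left ?_
  rintro ⟨y, hy, hiy⟩
  rw [← hc] at hy
  exact ⟨y, hy, by rwa [P.entryIds_of_live (h.consumed_in hG hy).2]⟩

theorem Enabled.produced_disjoint (R : Rules P lock Q) (hG : Good P db D)
    (h : Enabled P lock Q db r) :
    r.produced.Pairwise (fun a b => Disjoint (P.entryIds a) (P.entryIds b)) ∧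
    ∀ x ∈ r.produced, x.version ≠ 0 → x.id ∉ P.wrapped x.data := by
  have hp := h.proper R hG
  obtain ⟨o, ro, s, hl, -, hr⟩ := execute_iff_loads.1 h.exec
  have hc : r.consumed = o ++ s := by rw [hr]; rfl
  obtain ⟨h1, h2⟩ := R.sound.no_clone _ o ro s (hc ▸ hp)
  rw [hr]
  refine ⟨List.pairwise_map.2 (h1.imp fun {a b} hab => ?_), fun x hx hv => ?_⟩
  · rwa [entryIds_stamp P (lamport_ne_zero _), entryIds_stamp P (lamport_ne_zero _)]
  · obtain ⟨z, hz, rfl⟩ := List.mem_map.1 hx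
    refine h2 z hz ?_
    by_contra hd
    simp [OutObj.stamp, hd] at hv

theorem Enabled.produced_version (h : Enabled P lock Q db r) {x : Obj C} (hx : x ∈ r.produced) :
    (x.version ≠ 0 → x.version = lamport r.consumed) ∧ x.lastTx = some r.effects.tx := by
  obtain ⟨o, ro, s, hl, -, hr⟩ := execute_iff_loads.1 h.exec
  rw [hr] at hx ⊢
  clear hr h
  obtain ⟨z, hz, rfl⟩ := List.mem_map.1 hx
  refine ⟨fun hv => ?_, rfl⟩
  simp only [OutObj.stamp] at hv ⊢
  split at hv
  · exact absurd rfl hv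
  · next hd => rw [if_neg hd]; rfl

/-- An old entry sharing an identifier with an output is consumed. -/
theorem Enabled.mem_consumed_of_produced (R : Rules P lock Q) (hG : Good P db D)
    (h : Enabled P lock Q db r) {x z : Obj C} (hx : x ∈ r.produced) {i j : C.ObjID}
    (hi : i ∈ P.entryIds x) (hz : db j = some z) (hiz : i ∈ P.entryIds z) : z ∈ r.consumed := by
  rcases h.produced_ids R hG hx hi with ⟨y, hy, hiy⟩ | ⟨k, rfl⟩
  · have hy' := (h.consumed_in hG hy).1
    obtain rfl := hG.index_eq hy' hz hiy hiz
    rw [hy'] at hz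
    cases hz; exact hy
  · exact absurd (hG.known hz _ hiz _ _ rfl) (h.fresh hG)

theorem Enabled.produced_eq (R : Rules P lock Q) (hG : Good P db D)
    (h : Enabled P lock Q db r) {x z : Obj C} (hx : x ∈ r.produced) (hz : z ∈ r.produced)
    {i : C.ObjID} (hi : i ∈ P.entryIds x) (hiz : i ∈ P.entryIds z) : x = z := by
  by_contra hne
  have hs : Std.Symm (fun a b : Obj C => Disjoint (P.entryIds a) (P.entryIds b)) :=
    ⟨fun a b h => h.symm⟩
  exact Finset.disjoint_left.1
    ((h.produced_disjoint R hG).1.forall hx hz hne) hi hiz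

theorem apply_cases {i : C.ObjID} {o : Obj C} (h : db.apply r i = some o) :
    (o ∈ r.produced ∧ o.id = i) ∨
      (i ∉ r.producedIds ∧ i ∉ r.consumedIds ∧ db i = some o) := by
  unfold ObjDB.apply at h
  split at h
  · next o' ho' =>
    cases h
    exact .inl ⟨List.mem_of_find?_eq_some ho', by simpa using List.find?_some ho'⟩
  · next hn =>
    split at h
    · cases h
    · next hc =>
      refine .inr ⟨?_, ?_, h⟩
      · simpa [Record.producedIds] using hn
      · simpa [Record.consumedIds] using hc

theorem apply_of_notMem {i : C.ObjID} (hp : i ∉ r.producedIds) (hc : i ∉ r.consumedIds) :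
    db.apply r i = db i := by
  have h1 : r.produced.find? (fun o => o.id == i) = none := by
    simpa [Record.producedIds] using hp
  have h2 : r.consumed.any (fun o => o.id == i) = false := by
    simpa [Record.consumedIds] using hc
  simp [ObjDB.apply, h1, h2]

theorem apply_congr {db' : ObjDB C} {i : C.ObjID} (h : db i = db' i) :
    db.apply r i = db'.apply r i := by
  simp [ObjDB.apply, h]

/-- Outputs land only on consumed entries or on empty places; in particular no tombstone is
overwritten. -/
theorem Enabled.notMem_producedIds (R : Rules P lock Q) (hG : Good P db D)
    (h : Enabled P lock Q db r) {i : C.ObjID} {o : Obj C} (ho : db i = some o)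
    (hi : i ∉ r.consumedIds) : i ∉ r.producedIds := by
  intro hp
  obtain ⟨x, hx, rfl⟩ := List.mem_map.1 hp
  have := h.mem_consumed_of_produced R hG hx (P.id_mem_entryIds x) ho
    (by rw [← hG.id_eq ho]; exact P.id_mem_entryIds o)
  exact hi (List.mem_map.2 ⟨o, this, hG.id_eq ho⟩)

theorem Known.mono {D' : Set C.Digest} {i : C.ObjID} (h : Known P D i) (hD : D ⊆ D') :
    Known P D' i := fun d k hk => hD (h d k hk)

theorem Enabled.apply_produced (R : Rules P lock Q) (hG : Good P db D)
    (h : Enabled P lock Q db r) {x : Obj C} (hx : x ∈ r.produced) :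
    db.apply r x.id = some x := by
  cases hf : r.produced.find? (fun o => o.id == x.id) with
  | none => simp at hf; exact absurd rfl (hf x hx)
  | some z =>
    have hz : z.id = x.id := by simpa using List.find?_some hf
    have := h.produced_eq R hG hx (List.mem_of_find?_eq_some hf) (P.id_mem_entryIds x)
      (hz ▸ P.id_mem_entryIds z)
    rw [← this] at hf
    simp [ObjDB.apply, hf]

/-- An identifier reaches an output either from a consumed object, whose version the Lamport stamp
exceeds, or by derivation from a fresh digest, which `Known` rules out for a dead key. So the
versions found above a dead key only grow. -/
theorem Enabled.dead_step (R : Rules P lock Q) (hG : Good P db D) (h : Enabled P lock Q db r)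
    {k : ObjKey C} (hk : Dead P D db k) : Dead P (insert r.effects.tx D) (db.apply r) k := by
  refine ⟨hk.1.mono (Set.subset_insert _ _), fun i o ho hv hi => ?_⟩
  rcases apply_cases ho with ⟨ho, -⟩ | ⟨-, -, ho⟩
  · rw [← P.entryIds_of_live hv] at hi
    rcases h.produced_ids R hG ho hi with ⟨y, hy, hiy⟩ | ⟨m, hm⟩
    · obtain ⟨h1, h2⟩ := h.consumed_in hG hy
      rw [P.entryIds_of_live h2] at hiy
      rw [(h.produced_version ho).1 hv]
      exact (hk.2 _ _ h1 h2 hiy).trans (lt_lamport hy)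
    · exact absurd (hk.1 _ _ hm) (h.fresh hG)
  · exact hk.2 i o ho hv hi

/-- A live entry that contains the identifier afterwards is an output, with a larger version; an
untouched entry containing it would have shared it with the consumed object before. -/
theorem Enabled.dead_of_consumed (hG : Good P db D)
    (h : Enabled P lock Q db r) {x : Obj C} (hx : x ∈ r.consumed) :
    Dead P (insert r.effects.tx D) (db.apply r) x.key := by
  obtain ⟨h1, h2⟩ := h.consumed_in hG hx
  refine ⟨(hG.known h1 _ (P.id_mem_entryIds x)).mono (Set.subset_insert _ _),
    fun i o ho hv hi => ?_⟩
  rcases apply_cases ho with ⟨ho, -⟩ | ⟨-, hc, ho⟩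
  · rw [(h.produced_version ho).1 hv]
    exact lt_lamport hx
  · rw [← P.entryIds_of_live hv] at hi
    have := hG.index_eq h1 ho (P.id_mem_entryIds x) hi
    exact absurd (List.mem_map_of_mem hx) (this ▸ hc)

theorem Enabled.good_step (R : Rules P lock Q) (hG : Good P db D) (h : Enabled P lock Q db r) :
    Good P (db.apply r) (insert r.effects.tx D) where
  id_eq hi := by
    rcases apply_cases hi with ⟨-, h⟩ | ⟨-, -, h⟩
    · exact h
    · exact hG.id_eq h
  disjoint {i j o o'} hi hj hne := by
    rw [Finset.disjoint_left]
    intro m hm hm'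
    rcases apply_cases hi with ⟨ho, rfl⟩ | ⟨-, hc, ho⟩ <;>
      rcases apply_cases hj with ⟨ho', rfl⟩ | ⟨-, hc', ho'⟩
    · exact hne (by rw [h.produced_eq R hG ho ho' hm hm'])
    · have := h.mem_consumed_of_produced R hG ho hm ho' hm'
      exact hc' (List.mem_map.2 ⟨_, this, hG.id_eq ho'⟩)
    · have := h.mem_consumed_of_produced R hG ho' hm' ho hm
      exact hc (List.mem_map.2 ⟨_, this, hG.id_eq ho⟩)
    · exact hne (hG.index_eq ho ho' hm hm')
  not_self_wrapped hi hv := by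
    rcases apply_cases hi with ⟨ho, -⟩ | ⟨-, -, ho⟩
    · exact (h.produced_disjoint R hG).2 _ ho hv
    · exact hG.not_self_wrapped ho hv
  known hi j hj := by
    rcases apply_cases hi with ⟨ho, -⟩ | ⟨-, -, ho⟩
    · rcases h.produced_ids R hG ho hj with ⟨y, hy, hjy⟩ | ⟨k, rfl⟩
      · exact (hG.known (h.consumed_in hG hy).1 j hjy).mono (Set.subset_insert _ _)
      · intro d k' hk
        rw [(R.sound.newId_injective _ _ _ _ hk).1]
        exact Set.mem_insert _ _
    · exact (hG.known ho j hj).mono (Set.subset_insert _ _)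
  spent tx ht := by
    rcases Set.mem_insert_iff.1 ht with ht | ht
    · rw [h.digest_eq] at ht
      rw [R.sound.digest_injective ht]
      -- The gas object is always an owned input, so each transaction has at least one owned key
      -- that its execution makes dead.
      have hg := (R.legit h.certified).gas
      obtain ⟨x, hx, hk⟩ := h.input_in hG hg
      exact ⟨_, hg, hk ▸ h.dead_of_consumed hG hx⟩
    · obtain ⟨k, hk, hd⟩ := hG.spent tx ht
      exact ⟨k, hk, h.dead_step R hG hd⟩

/-! ## Commutation -/

theorem isSharedFrom_of_isOwned {w : Owner C} (h : w.isOwned = true) (n : Version) :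
    w.isSharedFrom n = false := by
  cases w <;> simp_all [Owner.isOwned, Owner.isSharedFrom]

theorem isImmutable_of_isOwned {w : Owner C} (h : w.isOwned = true) : w.isImmutable = false := by
  cases w <;> simp_all [Owner.isOwned, Owner.isImmutable]

theorem isImmutable_of_isSharedFrom {w : Owner C} {n : Version} (h : w.isSharedFrom n = true) :
    w.isImmutable = false := by
  cases w <;> simp_all [Owner.isSharedFrom, Owner.isImmutable]

theorem Enabled.eq_of_tx_eq (h : Enabled P lock Q db r) (h' : Enabled P lock Q db r')
    (ht : r.cert.tx = r'.cert.tx) : r = r' := by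
  have h1 := h.exec
  rw [ht, h'.exec] at h1
  exact (Option.some.inj h1).symm

/-- A common object would be an owned input of both, against `key_unique`; or owned for one and
shared for the other, against its owner field; or shared in both and locked at the same version,
against `lock_unique`. -/
theorem Enabled.consumed_disjoint (R : Rules P lock Q) (hG : Good P db D)
    (h : Enabled P lock Q db r) (h' : Enabled P lock Q db r')
    (hne : r.cert.tx ≠ r'.cert.tx) {i : C.ObjID} (hi : i ∈ r.consumedIds) :
    i ∉ r'.consumedIds := by
  intro hi'
  obtain ⟨x, hx, rfl⟩ := List.mem_map.1 hi
  obtain ⟨y, hy, hxy⟩ := List.mem_map.1 hi'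
  have h1 := (h.consumed_in hG hx).1
  have h2 := (h'.consumed_in hG hy).1
  rw [hxy, h1] at h2
  cases h2
  obtain ⟨o, ro, s, hl, hs, hr⟩ := execute_iff_loads.1 h.exec
  obtain ⟨o', ro', s', hl', hs', hr'⟩ := execute_iff_loads.1 h'.exec
  have hxc : x ∈ o ++ s := by rw [hr] at hx; exact hx
  have hyc : x ∈ o' ++ s' := by rw [hr'] at hy; exact hy
  rcases List.mem_append.1 hxc with ho | ho <;> rcases List.mem_append.1 hyc with ho' | ho'
  · obtain ⟨k, hk, h1, -, h2⟩ := forall₂_exists_of_mem_right hl.owned ho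
    obtain ⟨k', hk', h1', -, h2'⟩ := forall₂_exists_of_mem_right hl'.owned ho'
    have : k = k' := Prod.ext ((hG.id_eq h1).symm.trans (hG.id_eq h1')) (h2.symm.trans h2')
    exact hne (R.key_unique h.certified h'.certified hk (this ▸ hk'))
  · obtain ⟨k, hk, h1, -, -⟩ := forall₂_exists_of_mem_right hl.owned ho
    obtain ⟨k', -, -, -, h2'⟩ := forall₂_exists_of_mem_right hl'.shared ho'
    have h3 := isSharedFrom_of_isOwned (h.owned k hk x h1)
    exact Bool.false_ne_true ((h3 _).symm.trans h2')
  · obtain ⟨k, -, -, -, h2⟩ := forall₂_exists_of_mem_right hl.shared ho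
    obtain ⟨k', hk', h1', -, -⟩ := forall₂_exists_of_mem_right hl'.owned ho'
    have h3 := isSharedFrom_of_isOwned (h'.owned k' hk' x h1')
    exact Bool.false_ne_true ((h3 _).symm.trans h2)
  · exact hne (R.sound.digest_injective (R.lock_unique (hs x ho) (hs' x ho')))

theorem Enabled.not_immutable
    (h : Enabled P lock Q db r) {x : Obj C} (hx : x ∈ r.consumed) :
    x.owner.isImmutable = false := by
  obtain ⟨o, ro, s, hl, hs, hr⟩ := execute_iff_loads.1 h.exec
  have hxc : x ∈ o ++ s := by rw [hr] at hx; exact hx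
  rcases List.mem_append.1 hxc with ho | ho
  · obtain ⟨k, hk, h1, -, h2⟩ := forall₂_exists_of_mem_right hl.owned ho
    exact isImmutable_of_isOwned (h.owned k hk x h1)
  · obtain ⟨k, hk, h1, -, h2⟩ := forall₂_exists_of_mem_right hl.shared ho
    exact isImmutable_of_isSharedFrom h2

/-- Every input of an enabled transaction is an entry of the store, whose last transaction is a
recorded dependency; the input is consumed or read-only. -/
theorem Enabled.input_cases (h : Enabled P lock Q db r) {i : C.ObjID}
    (hi : i ∈ r.cert.tx.mutIds ++ r.cert.tx.readonly) :
    ∃ x, db i = some x ∧ (∀ d, x.lastTx = some d → d ∈ r.effects.deps) ∧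
      (i ∈ r.cert.tx.mutIds ∨ x.owner.isImmutable = true) := by
  obtain ⟨o, ro, s, hl, hs, hr⟩ := execute_iff_loads.1 h.exec
  have hd : ∀ x ∈ o ++ ro ++ s, ∀ d, x.lastTx = some d → d ∈ r.effects.deps := by
    intro x hx d hd
    rw [hr]
    exact List.mem_filterMap.2 ⟨x, hx, hd⟩
  rcases List.mem_append.1 hi with hi | hi
  · rcases List.mem_append.1 hi with hi' | hi'
    · obtain ⟨k, hk, rfl⟩ := List.mem_map.1 hi'
      obtain ⟨x, hx, h1, -⟩ := forall₂_exists_of_mem_left hl.owned hk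
      exact ⟨x, h1, hd x (by simp [hx]), .inl hi⟩
    · obtain ⟨k, hk, rfl⟩ := List.mem_map.1 hi'
      obtain ⟨x, hx, h1, -⟩ := forall₂_exists_of_mem_left hl.shared hk
      exact ⟨x, h1, hd x (by simp [hx]), .inl hi⟩
  · obtain ⟨x, hx, h1, -, h2⟩ := forall₂_exists_of_mem_left hl.readonly hi
    exact ⟨x, h1, hd x (by simp [hx]), .inr h2⟩

/-- The other execution leaves all inputs alone: it consumes neither the mutable ones nor, as
consumed objects are owned or shared, the read-only ones; and what it does not consume it does not
overwrite. -/
theorem Enabled.diamond (R : Rules P lock Q) (hG : Good P db D) (h : Enabled P lock Q db r)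
    (h' : Enabled P lock Q db r') (hne : r.cert.tx ≠ r'.cert.tx) :
    Enabled P lock Q (db.apply r) r' := by
  refine h'.congr fun i hi => ?_
  obtain ⟨x, hx, -, hcase⟩ := h'.input_cases hi
  have hc : i ∉ r.consumedIds := by
    rcases hcase with hm | hm
    · rw [← h'.consumedIds_eq hG] at hm
      exact h'.consumed_disjoint R hG h hne.symm hm
    · intro hc
      obtain ⟨y, hy, rfl⟩ := List.mem_map.1 hc
      have := (h.consumed_in hG hy).1
      rw [hx] at this
      cases this
      simp [h.not_immutable hy] at hm
  exact apply_of_notMem (h.notMem_producedIds R hG hx hc) hc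

/-- Two outputs with the same identifier would trace it back to a common consumed object, or to both
digests, or to one digest and an entry of the old store, where identifiers of fresh digests do not
occur. -/
theorem Enabled.touched_disjoint (R : Rules P lock Q) (hG : Good P db D)
    (h : Enabled P lock Q db r) (h' : Enabled P lock Q db r') (hne : r.cert.tx ≠ r'.cert.tx)
    {i : C.ObjID} (hi : i ∈ r.producedIds ++ r.consumedIds) :
    i ∉ r'.producedIds ++ r'.consumedIds := by
  intro hi'
  have key : ∀ {a b : Record C}, Enabled P lock Q db a → Enabled P lock Q db b →
      a.cert.tx ≠ b.cert.tx → i ∈ a.producedIds → i ∉ b.consumedIds := by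
    intro a b ha hb hab hia hib
    obtain ⟨y, hy, rfl⟩ := List.mem_map.1 hib
    exact ha.notMem_producedIds R hG (hb.consumed_in hG hy).1
      (hb.consumed_disjoint R hG ha hab.symm hib) hia
  rcases List.mem_append.1 hi with hi | hi <;> rcases List.mem_append.1 hi' with hi' | hi'
  · obtain ⟨x, hx, rfl⟩ := List.mem_map.1 hi
    obtain ⟨x', hx', hxx⟩ := List.mem_map.1 hi'
    have hm' : x.id ∈ P.entryIds x' := hxx ▸ P.id_mem_entryIds x'
    rcases h.produced_ids R hG hx (P.id_mem_entryIds x) with ⟨y, hy, hy1⟩ | ⟨k, hk⟩ <;>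
      rcases h'.produced_ids R hG hx' hm' with ⟨y', hy', hy1'⟩ | ⟨k', hk'⟩
    · have := hG.index_eq (h.consumed_in hG hy).1 (h'.consumed_in hG hy').1 hy1 hy1'
      exact h.consumed_disjoint R hG h' hne (List.mem_map_of_mem hy)
        (this ▸ List.mem_map_of_mem hy')
    · exact h'.fresh hG (hG.known (h.consumed_in hG hy).1 _ hy1 _ _ hk')
    · exact h.fresh hG (hG.known (h'.consumed_in hG hy').1 _ hy1' _ _ hk)
    · have := (R.sound.newId_injective _ _ _ _ (hk.symm.trans hk')).1
      rw [h.digest_eq, h'.digest_eq] at this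
      exact hne (R.sound.digest_injective this)
  · exact key h h' hne hi hi'
  · exact key h' h hne.symm hi' hi
  · exact h.consumed_disjoint R hG h' hne hi hi'

theorem Enabled.apply_comm (R : Rules P lock Q) (hG : Good P db D) (h : Enabled P lock Q db r)
    (h' : Enabled P lock Q db r') (hne : r.cert.tx ≠ r'.cert.tx) :
    (db.apply r).apply r' = (db.apply r').apply r := by
  funext i
  by_cases hi : i ∈ r.producedIds ++ r.consumedIds
  · have hi' := h.touched_disjoint R hG h' hne hi
    rw [List.mem_append, not_or] at hi'
    rw [apply_of_notMem hi'.1 hi'.2]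
    exact apply_congr (apply_of_notMem hi'.1 hi'.2).symm
  · rw [List.mem_append, not_or] at hi
    rw [apply_of_notMem (db := db.apply r') hi.1 hi.2]
    exact apply_congr (apply_of_notMem hi.1 hi.2)

/-- A transaction that does not depend on the last one could have been executed before it. -/
theorem Enabled.of_not_dep (h : Enabled P lock Q db r) (h' : Enabled P lock Q (db.apply r) r')
    (hd : r.effects.tx ∉ r'.effects.deps) : Enabled P lock Q db r' := by
  refine h'.congr fun i hi => ?_
  obtain ⟨x, hx, hdep, -⟩ := h'.input_cases hi
  -- An input written by `r` would carry the digest of `r` as its last transaction and make it a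
  -- dependency. Any other input was there before.
  rcases apply_cases hx with ⟨hp, -⟩ | ⟨-, -, hx'⟩
  · exact absurd (hdep _ (h.produced_version hp).2) hd
  · rw [hx', hx]

/-- Deleting the outputs that are not restored inputs is correct because such an identifier had no
entry before the execution, not even a tombstone. -/
theorem Enabled.undo_apply (R : Rules P lock Q) (hG : Good P db D) (h : Enabled P lock Q db r) :
    (db.apply r).undo r = db := by
  funext i
  unfold ObjDB.undo
  split
  · next o ho =>
    have h1 := List.mem_of_find?_eq_some ho
    have h2 : o.id = i := by simpa using List.find?_some ho
    rw [← h2]; exact (h.consumed_in hG h1).1.symm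
  · next hn =>
    have hc : i ∉ r.consumedIds := by simpa [Record.consumedIds] using hn
    split
    · next hp =>
      have hp' : i ∈ r.producedIds := by simpa [Record.producedIds] using hp
      cases hdb : db i with
      | none => rfl
      | some z => exact absurd hp' (h.notMem_producedIds R hG hdb hc)
    · next hp =>
      exact apply_of_notMem (by simpa [Record.producedIds] using hp) hc

end executions

/-! ## Traces of executions -/

/-- The records are those of successive executions from `db`. -/
def Valid (P : Platform C) (lock : SharedLock C) (Q : Tx C → Prop) :
    ObjDB C → List (Record C) → Prop
  | _, [] => True
  | db, r :: l => Enabled P lock Q db r ∧ Valid P lock Q (db.apply r) l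

/-- The store after the executions in the list. -/
abbrev ObjDB.after (db : ObjDB C) (l : List (Record C)) : ObjDB C := l.foldl ObjDB.apply db

def digests (l : List (Record C)) : List C.Digest := l.map (fun r => r.effects.tx)

/-- The records whose digests are not in the list. -/
def without (ds : List C.Digest) (l : List (Record C)) : List (Record C) :=
  l.filter (fun r => decide (r.effects.tx ∉ ds))

section traces
variable {P : Platform C} {lock : SharedLock C} {Q : Tx C → Prop} {db : ObjDB C}
  {D : Set C.Digest} {r r' : Record C} {l l' : List (Record C)}

theorem mem_digests {d : C.Digest} : d ∈ digests l ↔ ∃ r ∈ l, r.effects.tx = d := by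
  simp [digests]

theorem mem_without {ds : List C.Digest} : r ∈ without ds l ↔ r ∈ l ∧ r.effects.tx ∉ ds := by
  simp [without]

theorem without_eq_self {ds : List C.Digest} (h : ∀ r ∈ l, r.effects.tx ∉ ds) :
    without ds l = l := by
  simpa [without] using h

theorem valid_append : Valid P lock Q db (l ++ l') ↔
    Valid P lock Q db l ∧ Valid P lock Q (db.after l) l' := by
  induction l generalizing db with
  | nil => simp [Valid]
  | cons r l ih => simp [Valid, ih, and_assoc]

theorem Valid.mono {lock' : SharedLock C} {Q' : Tx C → Prop} (hl : LockLe lock lock')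
    (hQ : ∀ tx, Q tx → Q' tx) (h : Valid P lock Q db l) : Valid P lock' Q' db l := by
  induction l generalizing db with
  | nil => trivial
  | cons r l ih => exact ⟨h.1.mono hl hQ, ih h.2⟩

/-- The digests of the executed transactions. -/
def executed (D : Set C.Digest) (l : List (Record C)) : Set C.Digest := D ∪ {d | d ∈ digests l}

theorem executed_nil : executed D [] = D := by simp [executed, digests]

theorem executed_cons : executed D (r :: l) = executed (insert r.effects.tx D) l := by
  ext d; simp [executed, digests]; tauto

theorem executed_concat : executed D (l ++ [r]) = insert r.effects.tx (executed D l) := by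
  ext d
  by_cases hd : d = r.effects.tx <;> simp [executed, digests, hd]

theorem Valid.good (R : Rules P lock Q) (hG : Good P db D) (h : Valid P lock Q db l) :
    Good P (db.after l) (executed D l) := by
  induction l generalizing db D with
  | nil => rw [executed_nil]; exact hG
  | cons r l ih => rw [executed_cons]; exact ih (h.1.good_step R hG) h.2

theorem Valid.notMem (R : Rules P lock Q) (hG : Good P db D) (h : Valid P lock Q db l)
    (hr : r ∈ l) : r.effects.tx ∉ D := by
  induction l generalizing db D with
  | nil => simp at hr
  | cons u l ih =>
    rcases List.mem_cons.1 hr with rfl | hr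
    · exact h.1.fresh hG
    · exact fun hd => ih (h.1.good_step R hG) h.2 hr (Set.mem_insert_of_mem _ hd)

theorem Valid.nodup (R : Rules P lock Q) (hG : Good P db D) (h : Valid P lock Q db l) :
    (digests l).Nodup := by
  induction l generalizing db D with
  | nil => simp [digests]
  | cons u l ih =>
    refine List.nodup_cons.2 ⟨fun hm => ?_, ih (h.1.good_step R hG) h.2⟩
    obtain ⟨r, hr, he⟩ := mem_digests.1 hm
    exact h.2.notMem R (h.1.good_step R hG) hr (he ▸ Set.mem_insert _ _)

theorem Valid.eq_of_digest_eq (R : Rules P lock Q) (hG : Good P db D) (h : Valid P lock Q db l)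
    (hr : r ∈ l) (hr' : r' ∈ l) (he : r.effects.tx = r'.effects.tx) : r = r' :=
  List.inj_on_of_nodup_map (h.nodup R hG) hr hr' he

theorem Valid.undo (R : Rules P lock Q) (hG : Good P db D) (h : Valid P lock Q db l) :
    l.reverse.foldl ObjDB.undo (db.after l) = db := by
  induction l generalizing db D with
  | nil => rfl
  | cons r l ih =>
    rw [List.reverse_cons, List.foldl_append]
    refine Eq.trans ?_ (h.1.undo_apply R hG)
    exact congrArg (fun s => ObjDB.undo s r) (ih (h.1.good_step R hG) h.2)

/-- An enabled execution is either part of a trace, and may then be moved to its front, or it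
remains enabled along the trace. -/
theorem Valid.advance (R : Rules P lock Q) (hG : Good P db D) (hr : Enabled P lock Q db r)
    (h : Valid P lock Q db l) :
    (r ∈ l ∧ Valid P lock Q (db.apply r) (without [r.effects.tx] l) ∧
      (db.apply r).after (without [r.effects.tx] l) = db.after l) ∨
    (r.effects.tx ∉ digests l ∧ Valid P lock Q (db.apply r) l ∧
      Enabled P lock Q (db.after l) r) := by
  induction l generalizing db D with
  | nil => exact .inr ⟨by simp [digests], trivial, hr⟩
  | cons u l ih =>
    -- If the head runs the same transaction, determinism makes it the same record, already in
    -- front. Otherwise the diamond swaps the two, and the induction continues behind `u`.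
    by_cases ht : r.cert.tx = u.cert.tx
    · obtain rfl := hr.eq_of_tx_eq h.1 ht
      have hw : without [r.effects.tx] (r :: l) = l := by
        have : without [r.effects.tx] l = l := without_eq_self fun x hx => by
          simpa using fun he : x.effects.tx = r.effects.tx =>
            h.2.notMem R (hr.good_step R hG) hx (he ▸ Set.mem_insert _ _)
        conv_rhs => rw [← this]
        simp [without]
      rw [hw]
      exact .inl ⟨by simp, h.2, rfl⟩
    · have hd : r.effects.tx ≠ u.effects.tx := fun he => ht <| by
        rw [hr.digest_eq, h.1.digest_eq] at he
        exact R.sound.digest_injective he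
      have h1 := hr.diamond R hG h.1 ht
      have h2 := h.1.diamond R hG hr (Ne.symm ht)
      have hc := hr.apply_comm R hG h.1 ht
      have hw : without [r.effects.tx] (u :: l) = u :: without [r.effects.tx] l := by
        simp [without, hd.symm]
      rcases ih (h.1.good_step R hG) h2 h.2 with ⟨hm, hv, he⟩ | ⟨hm, hv, he⟩
      · rw [hw]
        refine .inl ⟨by simp [hm], ⟨h1, hc ▸ hv⟩, ?_⟩
        rw [ObjDB.after, List.foldl_cons, hc]; exact he
      · refine .inr ⟨?_, ⟨h1, hc ▸ hv⟩, he⟩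
        simpa [digests, hd] using hm

/-- After a part of a trace, the remaining executions of the trace lead to the same store. -/
theorem Valid.residual (R : Rules P lock Q) (hG : Good P db D) (hl' : Valid P lock Q db l')
    (hl : Valid P lock Q db l) (hsub : ∀ r ∈ l', r ∈ l) :
    Valid P lock Q (db.after l') (without (digests l') l) ∧
      (db.after l').after (without (digests l') l) = db.after l := by
  induction l' generalizing db D l with
  | nil =>
    have : without (digests []) l = l := without_eq_self fun x _ => by simp [digests]
    rw [this]; exact ⟨hl, rfl⟩
  | cons r l' ih =>
    have hG' := hl'.1.good_step R hG
    -- Move the first execution of `l'` to the front of `l` and strip it from both.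
    rcases hl.advance R hG hl'.1 with ⟨hm, hv, he⟩ | ⟨hm, -⟩
    · have := ih hG' hl'.2 hv fun x hx => mem_without.2 ⟨hsub x (by simp [hx]), by
        simpa using fun he : x.effects.tx = r.effects.tx =>
          hl'.2.notMem R hG' hx (he ▸ Set.mem_insert _ _)⟩
      have hw : without (digests l') (without [r.effects.tx] l) =
          without (digests (r :: l')) l := by
        simp only [without, List.filter_filter, digests, List.map_cons]
        refine List.filter_congr fun x _ => ?_
        by_cases hx : x.effects.tx = r.effects.tx <;> simp [hx]
      rw [hw, he] at this
      exact this
    · exact absurd (mem_digests.2 ⟨r, hsub r (by simp), rfl⟩) hm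

/-- A new execution at the end of a part of a trace either occurs in the trace or extends it. -/
theorem Valid.absorb (R : Rules P lock Q) (hG : Good P db D) (hl' : Valid P lock Q db l')
    (hl : Valid P lock Q db l) (hsub : ∀ r ∈ l', r ∈ l) (hr : Enabled P lock Q (db.after l') r) :
    r ∈ l ∨ Valid P lock Q db (l ++ [r]) := by
  obtain ⟨h1, h2⟩ := hl'.residual R hG hl hsub
  -- The executions of `l` outside `l'` form a trace from the very store in which `r` is enabled,
  -- and they end in the same store as `l`.
  rcases h1.advance R (hl'.good R hG) hr with ⟨hm, -⟩ | ⟨-, -, he⟩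
  · exact .inl (mem_without.1 hm).1
  · rw [h2] at he
    exact .inr (valid_append.2 ⟨hl, he, trivial⟩)

/-! ## Causal past -/

/-- An execution on which nothing later depends can be postponed past all later ones and then
dropped. -/
theorem Valid.of_not_dep (R : Rules P lock Q) (hG : Good P db D) (hr : Enabled P lock Q db r)
    (h : Valid P lock Q (db.apply r) l) (hd : ∀ u ∈ l, r.effects.tx ∉ u.effects.deps) :
    Valid P lock Q db l := by
  induction l generalizing db D with
  | nil => trivial
  | cons u l ih =>
    have hu := hr.of_not_dep h.1 (hd u (by simp))
    have hne : u.cert.tx ≠ r.cert.tx := fun he => by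
      have h1 := h.1.fresh (hr.good_step R hG)
      rw [hu.digest_eq, he, ← hr.digest_eq] at h1
      exact h1 (Set.mem_insert _ _)
    refine ⟨hu, ih (hu.good_step R hG) (hu.diamond R hG hr hne) ?_ fun x hx => hd x (by simp [hx])⟩
    rw [hu.apply_comm R hG hr hne]
    exact h.2

/-- One step of the backward scan. `need` lists the targets and the dependencies of the records kept
so far; all that matters later is that it contains the latter. -/
theorem causalPast_cons (targets : List C.Digest) :
    ∃ need : List C.Digest, causalPast targets (r :: l) =
        (if r.effects.tx ∈ need then r :: causalPast targets l else causalPast targets l) ∧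
      ∀ u ∈ causalPast targets l, ∀ d ∈ u.effects.deps, d ∈ need := by
  let f : Record C → List (Record C) × List C.Digest → List (Record C) × List C.Digest :=
    fun r acc => if r.effects.tx ∈ acc.2 then (r :: acc.1, r.effects.deps ++ acc.2) else acc
  refine ⟨(l.foldr f ([], targets)).2, ?_, ?_⟩
  · change (f r (l.foldr f ([], targets))).1 = _
    simp only [f]
    split <;> rfl
  · change ∀ u ∈ (l.foldr f ([], targets)).1, ∀ d ∈ u.effects.deps, d ∈ _
    induction l with
    | nil => simp
    | cons a l ih =>
      intro u hu d hd
      rw [List.foldr_cons] at hu ⊢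
      generalize l.foldr f ([], targets) = acc at *
      simp only [f] at hu ⊢
      split at hu
      · next ha =>
        rw [if_pos ha]
        rcases List.mem_cons.1 hu with rfl | hu
        · exact List.mem_append_left _ hd
        · exact List.mem_append_right _ (ih u hu d hd)
      · next ha =>
        rw [if_neg ha]
        exact ih u hu d hd

theorem mem_of_mem_causalPast {targets : List C.Digest} (h : r ∈ causalPast targets l) :
    r ∈ l := by
  induction l with
  | nil => simp [causalPast] at h
  | cons a l ih =>
    obtain ⟨need, he, -⟩ := causalPast_cons (r := a) (l := l) targets
    rw [he] at h
    split at h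
    · rcases List.mem_cons.1 h with rfl | h
      · simp
      · simp [ih h]
    · simp [ih h]

theorem causalPast_map_bare (targets : List C.Digest) :
    (causalPast targets l).map Record.bare = causalPast targets (l.map Record.bare) := by
  have : ∀ l : List (Record C),
      (l.map Record.bare).foldr (fun r (acc : List (Record C) × List C.Digest) =>
        if r.effects.tx ∈ acc.2 then (r :: acc.1, r.effects.deps ++ acc.2) else acc)
        ([], targets) =
      Prod.map (List.map Record.bare) id
        (l.foldr (fun r (acc : List (Record C) × List C.Digest) =>
          if r.effects.tx ∈ acc.2 then (r :: acc.1, r.effects.deps ++ acc.2) else acc)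
          ([], targets)) := by
    intro l
    induction l with
    | nil => rfl
    | cons a l ih =>
      rw [List.map_cons, List.foldr_cons, List.foldr_cons, ih]
      generalize l.foldr _ _ = acc
      obtain ⟨x, y⟩ := acc
      by_cases ha : a.effects.tx ∈ y <;> simp [ha, Record.bare]
  exact (congrArg Prod.fst (this l)).symm

/-- A record dropped by the scan is no dependency of a later record that is kept, so the kept ones
run without it. -/
theorem Valid.causalPast (R : Rules P lock Q) (hG : Good P db D) (h : Valid P lock Q db l)
    (targets : List C.Digest) : Valid P lock Q db (causalPast targets l) := by
  induction l generalizing db D with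
  | nil => exact h
  | cons r l ih =>
    have h' := ih (h.1.good_step R hG) h.2
    obtain ⟨need, he, hn⟩ := causalPast_cons (r := r) (l := l) targets
    rw [he]
    split
    · exact ⟨h.1, h'⟩
    · next hr => exact h'.of_not_dep R hG h.1 fun u hu hd => hr (hn u hu _ hd)

/-! ## Objects that have ever existed -/

/-- The live object `o` is in the store `db` or is written by one of the executions. -/
def Hist (db : ObjDB C) (l : List (Record C)) (o : Obj C) : Prop :=
  o.version ≠ 0 ∧ (db o.id = some o ∨ ∃ r ∈ l, o ∈ r.produced)

theorem Hist.mono {o : Obj C} (h : Hist db l o) (hl : ∀ r ∈ l, r ∈ l') : Hist db l' o :=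
  ⟨h.1, h.2.imp_right fun ⟨r, hr, ho⟩ => ⟨r, hl r hr, ho⟩⟩

theorem hist_of_after (hG : ∀ i o, db i = some o → o.id = i) {i : C.ObjID} {o : Obj C}
    (h : db.after l i = some o) (hv : o.version ≠ 0) : Hist db l o := by
  induction l using List.reverseRecOn with
  | nil => exact ⟨hv, .inl (by rw [hG i o h]; exact h)⟩
  | append_singleton l r ih =>
    rw [ObjDB.after, List.foldl_append] at h
    rcases apply_cases h with ⟨hp, -⟩ | ⟨-, -, h⟩
    · exact ⟨hv, .inr ⟨r, by simp, hp⟩⟩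
    · exact (ih h).mono fun x hx => by simp [hx]

theorem hist_concat {o : Obj C} (h : Hist db (l ++ [r]) o) : Hist db l o ∨ o ∈ r.produced := by
  obtain ⟨hv, h | ⟨u, hu, ho⟩⟩ := h
  · exact .inl ⟨hv, .inl h⟩
  · rcases List.mem_append.1 hu with hu | hu
    · exact .inl ⟨hv, .inr ⟨u, hu, ho⟩⟩
    · rw [List.mem_singleton.1 hu] at ho
      exact .inr ho

/-- A live object leaves the store only by being consumed, and from then on its key is dead. -/
theorem Valid.hist_present_or_dead (R : Rules P lock Q) (hG : Good P db D)
    (h : Valid P lock Q db l) {o : Obj C} (ho : Hist db l o) :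
    db.after l o.id = some o ∨ Dead P (executed D l) (db.after l) o.key := by
  induction l using List.reverseRecOn with
  | nil =>
    obtain ⟨-, h | ⟨u, hu, -⟩⟩ := ho
    · exact .inl h
    · simp at hu
  | append_singleton l r ih =>
    obtain ⟨hl, hr, -⟩ := valid_append.1 h
    have hG' := hl.good R hG
    rw [executed_concat, ObjDB.after, List.foldl_append]
    rcases hist_concat ho with ho' | ho'
    · rcases ih hl ho' with hp | hd
      · by_cases hc : o.id ∈ r.consumedIds
        · obtain ⟨x, hx, hxo⟩ := List.mem_map.1 hc
          have := (hr.consumed_in hG' hx).1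
          rw [hxo, hp] at this
          cases this
          exact .inr (hr.dead_of_consumed hG' hx)
        · left
          rw [← hp]
          exact apply_of_notMem (hr.notMem_producedIds R hG' hp hc) hc
      · exact .inr (hr.dead_step R hG' hd)
    · exact .inl (hr.apply_produced R hG' ho')

/-- An output cannot reuse the key of an earlier object. If that object is still present, it is
consumed; otherwise its key is dead, and an object carrying the identifier has a larger version. In
both cases the Lamport stamp exceeds the old version. -/
theorem Valid.hist_unique (R : Rules P lock Q) (hG : Good P db D)
    (h : Valid P lock Q db l) {o o' : Obj C} (ho : Hist db l o) (ho' : Hist db l o')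
    (hk : o.key = o'.key) : o = o' := by
  induction l using List.reverseRecOn with
  | nil =>
    obtain ⟨-, h | ⟨u, hu, -⟩⟩ := ho
    · obtain ⟨-, h' | ⟨u, hu, -⟩⟩ := ho'
      · rw [show o.id = o'.id from congrArg Prod.fst hk, h'] at h
        exact (Option.some.inj h).symm
      · simp at hu
    · simp at hu
  | append_singleton l r ih =>
    obtain ⟨hl, hr, -⟩ := valid_append.1 h
    have hG' := hl.good R hG
    have key : ∀ {x y : Obj C}, y.version ≠ 0 → x.key = y.key → Hist db l x → y ∈ r.produced →
        False := by
      intro x y hyv hxy hx hy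
      have h1 : x.id = y.id := congrArg Prod.fst hxy
      have h2 : x.version = y.version := congrArg Prod.snd hxy
      have hy' := (hr.produced_version hy).1 hyv
      rcases hl.hist_present_or_dead R hG hx with hp | hd
      · have := hr.mem_consumed_of_produced R hG' hy (P.id_mem_entryIds y) hp
          (h1 ▸ P.id_mem_entryIds x)
        have := lt_lamport this
        rw [h2, hy'] at this
        exact lt_irrefl _ this
      · rcases hr.produced_ids R hG' hy (P.id_mem_entryIds y) with ⟨z, hz, hyz⟩ | ⟨k, hk⟩
        · obtain ⟨h3, h4⟩ := hr.consumed_in hG' hz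
          rw [P.entryIds_of_live h4, ← h1] at hyz
          have h5 : x.version < z.version := hd.2 _ _ h3 h4 hyz
          have := lt_lamport hz
          rw [← hy', ← h2] at this
          exact lt_asymm h5 this
        · exact hr.fresh hG' (hd.1 _ _ (h1.trans hk))
    rcases hist_concat ho with h1 | h1 <;> rcases hist_concat ho' with h2 | h2
    · exact ih hl h1 h2
    · exact (key ho'.1 hk h1 h2).elim
    · exact (key ho.1 hk.symm h2 h1).elim
    · exact hr.produced_eq R hG' h1 h2 (P.id_mem_entryIds o)
        ((show o.id = o'.id from congrArg Prod.fst hk) ▸ P.id_mem_entryIds o')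

end traces

/-! ## Shared locks -/

section locks
variable {P : Platform C} {cfg : Config C} {st : SeqState C}

/-- The shared locks of a transaction are assigned all at once, below the entries of the
next-shared-lock table, and no version of an object is assigned twice. -/
structure LockInv (P : Platform C) (st : SeqState C) : Prop where
  atomic : ∀ tx i n, st.sharedLock (P.digest tx) i = some n → st.sharedLocksExist P tx = true
  below : ∀ d i n, st.sharedLock d i = some n → ∃ m, st.nextShared i = some m ∧ n < m
  unique : ∀ {d d' i n}, st.sharedLock d i = some n → st.sharedLock d' i = some n → d = d'

/-- `st'` differs from `st` in the shared-lock stores at most. -/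
structure SameButLocks (st st' : SeqState C) : Prop where
  history : st'.history = st.history
  sequenced : st'.sequenced = st.sequenced
  checkpoints : st'.checkpoints = st.checkpoints
  checkpointDB : st'.checkpointDB = st.checkpointDB

theorem SameButLocks.trans {a b c : SeqState C} (h : SameButLocks a b) (h' : SameButLocks b c) :
    SameButLocks a c :=
  ⟨h'.1.trans h.1, h'.2.trans h.2, h'.3.trans h.3, h'.4.trans h.4⟩

theorem writeSharedLocks_same (P : Platform C) (tx : Tx C) (v : Version) (st : SeqState C) :
    SameButLocks st (st.writeSharedLocks P tx v) := by
  unfold SeqState.writeSharedLocks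
  induction tx.shared generalizing st with
  | nil => exact ⟨rfl, rfl, rfl, rfl⟩
  | cons p l ih =>
    rw [List.foldl_cons]
    refine SameButLocks.trans ?_ (ih _)
    exact ⟨rfl, rfl, rfl, rfl⟩

/-- The loop reads the table that it is changing. As no identifier is repeated, no entry is read
after its change, and all locks refer to the original table. -/
theorem writeSharedLocks_spec (P : Platform C) (tx : Tx C) (v : Version) (st : SeqState C)
    (hn : (tx.shared.map Prod.fst).Nodup) :
    (∀ d i, (d ≠ P.digest tx ∨ i ∉ tx.shared.map Prod.fst) →
      (st.writeSharedLocks P tx v).sharedLock d i = st.sharedLock d i) ∧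
    (∀ i, i ∉ tx.shared.map Prod.fst →
      (st.writeSharedLocks P tx v).nextShared i = st.nextShared i) ∧
    ∀ p ∈ tx.shared,
      (st.writeSharedLocks P tx v).sharedLock (P.digest tx) p.1 = some (st.nextVersion p) ∧
      (st.writeSharedLocks P tx v).nextShared p.1 = some (v + 1) := by
  unfold SeqState.writeSharedLocks
  generalize P.digest tx = e
  revert hn
  generalize tx.shared = l
  intro hn
  induction l generalizing st with
  | nil => simp
  | cons q l ih =>
    rw [List.map_cons, List.nodup_cons] at hn
    rw [List.foldl_cons]
    obtain ⟨h1, h2, h3⟩ := ih { st with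
      sharedLock := Function.update st.sharedLock e
        (Function.update (st.sharedLock e) q.1 (some (st.nextVersion q)))
      nextShared := Function.update st.nextShared q.1 (some (v + 1)) } hn.2
    refine ⟨fun d i hd => ?_, fun i hi => ?_, fun p hp => ?_⟩
    · rw [h1 d i (hd.imp_right fun h h' => h (List.mem_cons_of_mem _ h'))]
      by_cases hde : d = e
      · have hi : i ≠ q.1 := fun h => (hd.resolve_left (not_not.2 hde)) (by simp [h])
        simp [hde, hi]
      · simp [hde]
    · rw [List.map_cons, List.mem_cons, not_or] at hi
      rw [h2 i hi.2]
      simp [hi.1]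
    · rcases List.mem_cons.1 hp with rfl | hp
      · rw [h1 _ _ (.inr hn.1), h2 _ hn.1]
        simp
      · obtain ⟨h4, h5⟩ := h3 p hp
        have hpq : p.1 ≠ q.1 := fun h => hn.1 (h ▸ List.mem_map_of_mem hp)
        refine ⟨h4.trans ?_, h5⟩
        simp [SeqState.nextVersion, hpq]

theorem sharedLocksExist_iff {tx : Tx C} : st.sharedLocksExist P tx = true ↔
    ∀ p ∈ tx.shared, ∃ n, st.sharedLock (P.digest tx) p.1 = some n := by
  simp [SeqState.sharedLocksExist, Option.isSome_iff_exists]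

theorem assignSharedLocks_same (P : Platform C) (tx : Tx C) (st : SeqState C) :
    SameButLocks st (st.assignSharedLocks P tx) := by
  unfold SeqState.assignSharedLocks
  split
  · exact ⟨rfl, rfl, rfl, rfl⟩
  · exact writeSharedLocks_same _ _ _ _

/-- New locks are taken at the table entries, which lie above all versions assigned before, and the
entries are then raised past them. By atomicity, a transaction whose locks are not all assigned has
none, so no lock is overwritten. -/
theorem LockInv.assign (hP : Function.Injective P.digest) (h : LockInv P st) {tx : Tx C}
    (hn : (tx.shared.map Prod.fst).Nodup) :
    LockInv P (st.assignSharedLocks P tx) ∧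
      LockLe st.sharedLock (st.assignSharedLocks P tx).sharedLock := by
  unfold SeqState.assignSharedLocks
  split
  · exact ⟨h, fun _ _ _ h => h⟩
  next hex =>
  have hv : ∀ p ∈ tx.shared, st.nextVersion p ≤
      max ((tx.inputs.map Prod.snd).foldr max 1) ((tx.shared.map st.nextVersion).foldr max 1) :=
    fun p hp => le_max_of_le_right (le_foldr_max (List.mem_map_of_mem hp))
  revert hv
  dsimp only
  generalize max ((tx.inputs.map Prod.snd).foldr max 1)
    ((tx.shared.map st.nextVersion).foldr max 1) = v
  intro hv
  obtain ⟨h1, h2, h3⟩ := writeSharedLocks_spec P tx v st hn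
  have hnone : ∀ i n, st.sharedLock (P.digest tx) i ≠ some n :=
    fun i n hi => hex (h.atomic tx i n hi)
  have hcases : ∀ d i n, (st.writeSharedLocks P tx v).sharedLock d i = some n →
      st.sharedLock d i = some n ∨
        (d = P.digest tx ∧ ∃ p ∈ tx.shared, p.1 = i ∧ n = st.nextVersion p) := by
    intro d i n hd
    by_cases hdi : d ≠ P.digest tx ∨ i ∉ tx.shared.map Prod.fst
    · rw [h1 d i hdi] at hd; exact .inl hd
    · push Not at hdi
      obtain ⟨rfl, hi⟩ := hdi
      obtain ⟨p, hp, rfl⟩ := List.mem_map.1 hi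
      rw [(h3 p hp).1] at hd
      exact .inr ⟨rfl, p, hp, rfl, (Option.some.inj hd).symm⟩
  have hle : LockLe st.sharedLock (st.writeSharedLocks P tx v).sharedLock := by
    intro d i n hd
    rw [h1 d i (.inl ?_)]
    · exact hd
    · rintro rfl; exact hnone _ _ hd
  -- The default value of a missing table entry does no harm: by `below`, an object without an entry
  -- has no lock yet.
  have hfresh : ∀ d p, p ∈ tx.shared → st.sharedLock d p.1 ≠ some (st.nextVersion p) := by
    intro d p hp hd
    obtain ⟨m, hm, hlt⟩ := h.below _ _ _ hd
    simp [SeqState.nextVersion, hm] at hlt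
  refine ⟨⟨fun tx' i n ht => ?_, fun d i n hd => ?_, fun {d d' i n} hd hd' => ?_⟩, hle⟩
  · rw [sharedLocksExist_iff]
    rcases hcases _ _ _ ht with ht | ⟨ht, -⟩
    · intro p hp
      obtain ⟨m, hm⟩ := sharedLocksExist_iff.1 (h.atomic tx' i n ht) p hp
      exact ⟨m, hle _ _ _ hm⟩
    · rw [hP ht]
      exact fun p hp => ⟨_, (h3 p hp).1⟩
  · rcases hcases _ _ _ hd with hd | ⟨-, p, hp, rfl, rfl⟩
    · obtain ⟨m, hm, hlt⟩ := h.below _ _ _ hd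
      by_cases hi : i ∈ tx.shared.map Prod.fst
      · obtain ⟨p, hp, rfl⟩ := List.mem_map.1 hi
        refine ⟨_, (h3 p hp).2, ?_⟩
        have := hv p hp
        simp only [SeqState.nextVersion, hm, Option.getD_some] at this
        exact Nat.lt_succ_of_lt (lt_of_lt_of_le hlt this)
      · exact ⟨m, (h2 i hi).trans hm, hlt⟩
    · exact ⟨_, (h3 p hp).2, Nat.lt_succ_of_le (hv p hp)⟩
  · rcases hcases _ _ _ hd with hd | ⟨rfl, p, hp, rfl, rfl⟩ <;>
      rcases hcases _ _ _ hd' with hd' | ⟨rfl, p', hp', hpp, hpv⟩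
    · exact h.unique hd hd'
    · subst hpp; subst hpv
      exact absurd hd (hfresh _ _ hp')
    · exact absurd hd' (hfresh _ _ hp)
    · rfl

theorem LockInv.congr {st' : SeqState C} (h : LockInv P st)
    (h1 : st'.sharedLock = st.sharedLock) (h2 : st'.nextShared = st.nextShared) :
    LockInv P st' where
  atomic := by
    have : ∀ tx, st'.sharedLocksExist P tx = st.sharedLocksExist P tx := fun tx => by
      simp [SeqState.sharedLocksExist, h1]
    intro tx i n hi
    rw [this]; rw [h1] at hi; exact h.atomic tx i n hi
  below := by rw [h1, h2]; exact h.below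
  unique := by rw [h1]; exact h.unique

/-- What receiving certificates changes and what it preserves. -/
structure Received (P : Platform C) (K : Cert C → Prop) (st st' : SeqState C) : Prop where
  history : st'.history = st.history
  checkpoints : st'.checkpoints = st.checkpoints
  checkpointDB : st'.checkpointDB = st.checkpointDB
  locks : LockInv P st'
  le : LockLe st.sharedLock st'.sharedLock
  sequenced : ∀ c ∈ st'.sequenced, c ∈ st.sequenced ∨ K c

theorem LockInv.receive (hP : Function.Injective P.digest) {K : Cert C → Prop}
    (h : LockInv P st) {l : List (Cert C)} (hK : ∀ c ∈ l, K c)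
    (hn : ∀ c ∈ l, (c.tx.shared.map Prod.fst).Nodup) :
    Received P K st (l.foldl (SeqState.receive P) st) := by
  induction l generalizing st with
  | nil => exact ⟨rfl, rfl, rfl, h, fun _ _ _ h => h, fun c hc => .inl hc⟩
  | cons c l ih =>
    have hs := assignSharedLocks_same P c.tx st
    obtain ⟨hl, hle⟩ := h.assign hP (hn c (by simp))
    have hl' : LockInv P (st.receive P c) := hl.congr rfl rfl
    have := ih hl' (fun c hc => hK c (by simp [hc])) fun c hc => hn c (by simp [hc])
    refine ⟨this.1.trans hs.history, this.2.trans hs.checkpoints, this.3.trans hs.checkpointDB,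
      this.4, fun d i n hd => this.5 _ _ _ (hle _ _ _ hd), fun x hx => ?_⟩
    rcases this.6 x hx with hx | hx
    · have hx' : x ∈ (if (st.assignSharedLocks P c.tx).sequenced.any
          (fun c' => P.digest c'.tx == P.digest c.tx) then (st.assignSharedLocks P c.tx).sequenced
          else (st.assignSharedLocks P c.tx).sequenced ++ [c]) := hx
      rw [hs.sequenced] at hx'
      split at hx'
      · exact .inl hx'
      · rcases List.mem_append.1 hx' with hx' | hx'
        · exact .inl hx'
        · rw [List.mem_singleton.1 hx']
          exact .inr (hK c (by simp))
    · exact .inr hx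

/-- `st'` agrees with `st` in what checkpoint formation leaves alone. -/
structure SameLocks (st st' : SeqState C) : Prop where
  history : st'.history = st.history
  sharedLock : st'.sharedLock = st.sharedLock
  nextShared : st'.nextShared = st.nextShared
  sequenced : st'.sequenced = st.sequenced

theorem formCheckpoint_cases {st' : SeqState C} (h : st.formCheckpoint P = some st') :
    SameLocks st st' ∧ ∃ n pending targets, (∀ c ∈ pending, c ∈ st.sequenced) ∧
      st'.checkpoints = st.checkpoints ++ [causalPast targets
        (executeReady P st.sharedLock n st.checkpointDB pending)] ∧
      st'.checkpointDB = st.checkpointDB.after (causalPast targets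
        (executeReady P st.sharedLock n st.checkpointDB pending)) := by
  unfold SeqState.formCheckpoint at h
  split at h
  · cases h
  · dsimp only at h
    split at h
    · cases h
      exact ⟨⟨rfl, rfl, rfl, rfl⟩, _, _, _, fun c hc => (List.mem_filter.1 hc).1, rfl, rfl⟩
    · cases h

theorem formCheckpoints_induction {M : SeqState C → Prop}
    (step : ∀ st st', M st → st.formCheckpoint P = some st' → M st') (n : ℕ) (h : M st) :
    M (st.formCheckpoints P n) := by
  induction n generalizing st with
  | zero => exact h
  | succ n ih =>
    unfold SeqState.formCheckpoints
    cases hf : st.formCheckpoint P with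
    | none => exact h
    | some st' => exact ih (step _ _ h hf)

theorem formCheckpoints_sameLocks (n : ℕ) : SameLocks st (st.formCheckpoints P n) :=
  formCheckpoints_induction (M := SameLocks st)
    (fun _ _ h hf =>
      have h' := (formCheckpoint_cases hf).1
      ⟨h'.1.trans h.1, h'.2.trans h.2, h'.3.trans h.3, h'.4.trans h.4⟩)
    n ⟨rfl, rfl, rfl, rfl⟩

/-- The certificates in a commit. -/
def certsOf (items : Commit C) : List (Cert C) := items.filterMap Item.cert?

theorem mem_certsOf {items : Commit C} {c : Cert C} : c ∈ certsOf items ↔ Item.cert c ∈ items := by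
  simp only [certsOf, List.mem_filterMap]
  constructor
  · rintro ⟨x, hx, h⟩
    cases x <;> simp_all [Item.cert?]
  · exact fun h => ⟨_, h, rfl⟩

/-- A commit is processed by receiving its certificates and then forming checkpoints. -/
theorem commit_cases (P : Platform C) (cfg : Config C) (e : ℕ) (st : SeqState C)
    (items : Commit C) :
    (st.contract.phase = .done ∧ st.commit P cfg e items = st) ∨
    (st.contract.phase ≠ .done ∧ ∃ st0 st1 st2 n,
      SameLocks { st with history := st.history ++ [items] } st0 ∧
      st0.checkpoints = st.checkpoints ∧ st0.checkpointDB = st.checkpointDB ∧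
      st1 = (certsOf items).foldl (SeqState.receive P) st0 ∧ SameLocks st1 st2 ∧
      st2.checkpoints = st1.checkpoints ∧ st2.checkpointDB = st1.checkpointDB ∧
      st.commit P cfg e items = st2.formCheckpoints P n) := by
  unfold SeqState.commit
  split
  · next h => exact .inl ⟨h, rfl⟩
  · next h =>
    refine .inr ⟨h, { st with
      history := st.history ++ [items]
      contract := items.foldl (Contract.step cfg e st.checkpoints.length) st.contract },
      _, _, _, ⟨rfl, rfl, rfl, rfl⟩, rfl, rfl, rfl, ?_, ?_, ?_, rfl⟩
    · split <;> exact ⟨rfl, rfl, rfl, rfl⟩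
    · split <;> rfl
    · split <;> rfl

/-! ### Shared locks along the sequence of commits. -/

theorem LockInv.commit (hP : Function.Injective P.digest) (e : ℕ) (h : LockInv P st)
    {items : Commit C} (hn : ∀ c ∈ certsOf items, (c.tx.shared.map Prod.fst).Nodup) :
    LockInv P (st.commit P cfg e items) ∧
      LockLe st.sharedLock (st.commit P cfg e items).sharedLock ∧
      ∀ c ∈ (st.commit P cfg e items).sequenced, c ∈ st.sequenced ∨ c ∈ certsOf items := by
  rcases commit_cases P cfg e st items with
    ⟨-, he⟩ | ⟨-, st0, st1, st2, n, h0, -, -, h1, h2, -, -, he⟩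
  · rw [he]; exact ⟨h, fun _ _ _ h => h, fun c hc => .inl hc⟩
  · have hr := LockInv.receive hP (K := fun c => c ∈ certsOf items)
      (h.congr (st' := st0) h0.sharedLock h0.nextShared) (fun c hc => hc) hn
    rw [← h1] at hr
    have hf := formCheckpoints_sameLocks (P := P) (st := st2) n
    rw [he]
    refine ⟨hr.locks.congr (hf.sharedLock.trans h2.sharedLock) (hf.nextShared.trans h2.nextShared),
      ?_, ?_⟩
    · rw [hf.sharedLock, h2.sharedLock]
      have := hr.le
      rwa [h0.sharedLock] at this
    · rw [hf.sequenced, h2.sequenced]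
      have := hr.sequenced
      rwa [h0.sequenced] at this

theorem commit_history (P : Platform C) (cfg : Config C) (e : ℕ) (st : SeqState C)
    (items : Commit C) (hd : st.contract.phase ≠ .done) :
    (st.commit P cfg e items).history = st.history ++ [items] := by
  have hrec : ∀ (l : List (Cert C)) (s : SeqState C),
      (l.foldl (SeqState.receive P) s).history = s.history := by
    intro l
    induction l with
    | nil => exact fun _ => rfl
    | cons c l ih => exact fun s => (ih _).trans (assignSharedLocks_same P c.tx s).history
  rcases commit_cases P cfg e st items with
    ⟨h, -⟩ | ⟨-, st0, st1, st2, n, h0, -, -, h1, h2, -, -, he⟩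
  · exact absurd h hd
  · rw [he, (formCheckpoints_sameLocks n).history, h2.history, h1, hrec, h0.history]

theorem commit_of_done {e : ℕ} {items : Commit C} (hd : st.contract.phase = .done) :
    st.commit P cfg e items = st := if_pos hd

theorem foldl_commit_of_done {e : ℕ} {l : List (Commit C)} (hd : st.contract.phase = .done) :
    l.foldl (SeqState.commit P cfg e) st = st := by
  induction l with
  | nil => rfl
  | cons a l ih => rw [List.foldl_cons, commit_of_done hd, ih]

/-- All certificates in the commits satisfy `K`. -/
def AllCerts (K : Cert C → Prop) (log : List (Commit C)) : Prop :=
  ∀ items ∈ log, ∀ c ∈ certsOf items, K c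

theorem LockInv.foldl_commit (hP : Function.Injective P.digest) (e : ℕ) {K : Cert C → Prop}
    (hK : ∀ c, K c → (c.tx.shared.map Prod.fst).Nodup) (h : LockInv P st)
    {log : List (Commit C)} (hlog : AllCerts K log) :
    LockInv P (log.foldl (SeqState.commit P cfg e) st) ∧
      LockLe st.sharedLock (log.foldl (SeqState.commit P cfg e) st).sharedLock ∧
      ∀ c ∈ (log.foldl (SeqState.commit P cfg e) st).sequenced, c ∈ st.sequenced ∨ K c := by
  induction log generalizing st with
  | nil => exact ⟨h, fun _ _ _ h => h, fun c hc => .inl hc⟩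
  | cons items log ih =>
    obtain ⟨h1, h2, h3⟩ := h.commit (cfg := cfg) hP e (items := items)
      fun c hc => hK c (hlog items (by simp) c hc)
    obtain ⟨h4, h5, h6⟩ := ih h1 fun a ha => hlog a (by simp [ha])
    refine ⟨h4, fun d i n hd => h5 _ _ _ (h2 _ _ _ hd), fun c hc => ?_⟩
    rcases h6 c hc with hc | hc
    · exact (h3 c hc).imp_right fun hc => hlog items (by simp) c hc
    · exact .inr hc

theorem lockInv_fresh (P : Platform C) (db : ObjDB C) (next : C.ObjID → Option Version) :
    LockInv P (.fresh db next) where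
  atomic _ _ _ h := by simp [SeqState.fresh] at h
  below _ _ _ h := by simp [SeqState.fresh] at h
  unique h := by simp [SeqState.fresh] at h

end locks

/-! ## One trace for all nodes -/

section absorb
variable {P : Platform C} {lock : SharedLock C} {Q : Tx C → Prop} {db : ObjDB C}
  {D : Set C.Digest} {l l' : List (Record C)}

/-- The owned inputs of the transaction have existed, and were owned. -/
def OwnedInputs (db : ObjDB C) (l : List (Record C)) (tx : Tx C) : Prop :=
  ∀ k ∈ tx.inputs, ∃ o, Hist db l o ∧ o.key = k ∧ o.owner.isOwned = true

theorem OwnedInputs.mono {tx : Tx C} (h : OwnedInputs db l tx) (hl : ∀ r ∈ l, r ∈ l') :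
    OwnedInputs db l' tx := fun k hk =>
  let ⟨o, ho, h'⟩ := h k hk
  ⟨o, ho.mono hl, h'⟩

/-- The execution of a certified transaction after a part of a common trace belongs to the common
trace, possibly extended. -/
theorem absorb_execution (R : Rules P lock Q) (hG : Good P db D) (hl : Valid P lock Q db l)
    (hl' : Valid P lock Q db l') (hsub : ∀ r ∈ l', r ∈ l) {c : Cert C} {r : Record C}
    (hown : OwnedInputs db l c.tx) (hc : Q c.tx)
    (hr : execute P lock (db.after l') c = some r) :
    ∃ m, (∀ u ∈ l, u ∈ m) ∧ Valid P lock Q db m ∧ Valid P lock Q db (l' ++ [r.bare]) ∧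
      r.bare ∈ m := by
  obtain ⟨hb, hcert⟩ := execute_bare hr
  have hG' := hl'.good R hG
  have hen : Enabled P lock Q (db.after l') r.bare := by
    refine ⟨by rw [show r.bare.cert.tx = c.tx by rw [← hcert]; rfl]; exact hb,
      by rw [show r.bare.cert.tx = c.tx by rw [← hcert]; rfl]; exact hc, fun k hk x hx => ?_⟩
    rw [show r.bare.cert.tx = c.tx by rw [← hcert]; rfl] at hk
    obtain ⟨o, ho, hok, hoo⟩ := hown k hk
    obtain ⟨_, _, _, hld, -, -⟩ := execute_iff_loads.1 hr
    obtain ⟨y, -, hy, hyv, hyk⟩ := forall₂_exists_of_mem_left hld.owned hk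
    rw [hx] at hy
    cases hy
    -- Execution does not check ownership. The loaded object has the key of an object known to have
    -- been owned; both belong to the history of the common trace, where a key determines the
    -- object.
    have hh := (hist_of_after (fun _ _ => hG.id_eq) hx hyv).mono hsub
    rwa [hl.hist_unique R hG hh ho (hok ▸ Prod.ext (hG'.id_eq hx) hyk)]
  have hv : Valid P lock Q db (l' ++ [r.bare]) := valid_append.2 ⟨hl', hen, trivial⟩
  rcases hl'.absorb R hG hl hsub hen with h | h
  · exact ⟨l, fun _ h => h, hl, hv, h⟩
  · exact ⟨l ++ [r.bare], fun u hu => by simp [hu], h, hv, by simp⟩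

theorem executeReady_subset {n : ℕ} {pending : List (Cert C)} {r : Record C}
    (hr : r ∈ executeReady P lock n db pending) : r.cert ∈ pending := by
  induction n generalizing db pending with
  | zero => simp [executeReady] at hr
  | succ n ih =>
    unfold executeReady at hr
    split at hr
    · simp at hr
    · next r' hr' =>
      rcases List.mem_cons.1 hr with rfl | hr
      · obtain ⟨c, hc, hx⟩ := List.exists_of_findSome?_eq_some hr'
        rw [(execute_bare hx).2]; exact hc
      · exact (List.mem_filter.1 (ih hr)).1

/-- The trial run that precedes a checkpoint is one more schedule of certified transactions, and is
absorbed one execution at a time like the work of a validator. -/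
theorem absorb_executeReady (R : Rules P lock Q) (hG : Good P db D) (n : ℕ)
    {pending : List (Cert C)} (hown : ∀ c ∈ pending, OwnedInputs db l c.tx)
    (hc : ∀ c ∈ pending, Q c.tx) (hl : Valid P lock Q db l) (hl' : Valid P lock Q db l')
    (hsub : ∀ r ∈ l', r ∈ l) :
    ∃ m, (∀ u ∈ l, u ∈ m) ∧ Valid P lock Q db m ∧
      Valid P lock Q db (l' ++ (executeReady P lock n (db.after l') pending).map Record.bare) ∧
      ∀ u ∈ (executeReady P lock n (db.after l') pending).map Record.bare, u ∈ m := by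
  induction n generalizing l l' pending with
  | zero => exact ⟨l, fun _ h => h, hl, by simpa [executeReady] using hl', by simp [executeReady]⟩
  | succ n ih =>
    unfold executeReady
    split
    · exact ⟨l, fun _ h => h, hl, by simpa using hl', by simp⟩
    · next r hr =>
      obtain ⟨c, hcp, hx⟩ := List.exists_of_findSome?_eq_some hr
      obtain ⟨m, h1, h2, h3, h4⟩ := absorb_execution R hG hl hl' hsub (hown c hcp) (hc c hcp) hx
      have hafter : db.after (l' ++ [r.bare]) = (db.after l').apply r := by
        rw [ObjDB.after, List.foldl_append]; rfl
      obtain ⟨m', h5, h6, h7, h8⟩ := ih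
        (pending := pending.filter (fun c => P.digest c.tx != r.effects.tx))
        (fun c hc => (hown c (List.mem_filter.1 hc).1).mono h1)
        (fun c hc' => hc c (List.mem_filter.1 hc').1) h2 h3 (fun u hu => by
          rcases List.mem_append.1 hu with hu | hu
          · exact h1 u (hsub u hu)
          · rw [List.mem_singleton.1 hu]; exact h4)
      rw [hafter] at h7 h8
      refine ⟨m', fun u hu => h5 u (h1 u hu), h6, by simpa using h7, fun u hu => ?_⟩
      rw [List.map_cons, List.mem_cons] at hu
      rcases hu with rfl | hu
      · exact h5 _ h4
      · exact h8 u hu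

end absorb

/-! ## Checkpoints -/

section checkpoints
variable {P : Platform C} {cfg : Config C} {e : ℕ}

/-- The records in the checkpoints formed so far. -/
def SeqState.records (st : SeqState C) : List (Record C) := st.checkpoints.flatten

/-- The checkpoints form a trace, which leads to the checkpointed store and is a part of `l`. -/
structure Checkpointed (P : Platform C) (e : ℕ) (lock : SharedLock C) (Q : Tx C → Prop)
    (db : ObjDB C) (l : List (Record C)) (st : SeqState C) : Prop where
  db_eq : st.checkpointDB = db.after (st.records.map Record.bare)
  valid : Valid P lock Q db (st.records.map Record.bare)
  sub : ∀ r ∈ st.records.map Record.bare, r ∈ l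
  epoch : ∀ r ∈ st.records, r.cert.epoch = e

theorem after_append (db : ObjDB C) (l l' : List (Record C)) :
    db.after (l ++ l') = (db.after l).after l' := List.foldl_append

theorem after_map_bare (db : ObjDB C) (l : List (Record C)) :
    db.after (l.map Record.bare) = db.after l := by
  rw [ObjDB.after, List.foldl_map]; rfl

/-- Receiving certificates only extends the locks. Each new checkpoint is a causal past inside a
trial run from the checkpointed store. The whole trial run goes into the common trace, where the
executions outside the checkpoint do no harm. -/
theorem Checkpointed.commit {lock lock' : SharedLock C} {K : Cert C → Prop} {db : ObjDB C}
    {D : Set C.Digest} {l : List (Record C)} {st : SeqState C} {items : Commit C}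
    (hlock' : lock' = (st.commit P cfg e items).sharedLock) (hle : LockLe lock lock')
    (R : Rules P lock' (fun tx => ∃ c, K c ∧ c.tx = tx)) (hG : Good P db D)
    (hlocks : LockInv P st) (hK : ∀ c, K c → c.epoch = e ∧ OwnedInputs db l c.tx)
    (hseq : ∀ c ∈ st.sequenced, K c) (hitems : ∀ c ∈ certsOf items, K c)
    (hl : Valid P lock (fun tx => ∃ c, K c ∧ c.tx = tx) db l)
    (h : Checkpointed P e lock (fun tx => ∃ c, K c ∧ c.tx = tx) db l st) :
    ∃ m, (∀ u ∈ l, u ∈ m) ∧ Valid P lock' (fun tx => ∃ c, K c ∧ c.tx = tx) db m ∧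
      Checkpointed P e lock' (fun tx => ∃ c, K c ∧ c.tx = tx) db m
        (st.commit P cfg e items) := by
  have hl' := hl.mono (Q' := fun tx => ∃ c, K c ∧ c.tx = tx) hle fun _ h => h
  have hcv := h.valid.mono (Q' := fun tx => ∃ c, K c ∧ c.tx = tx) hle fun _ h => h
  have hn : ∀ c ∈ certsOf items, (c.tx.shared.map Prod.fst).Nodup := fun c hc =>
    (List.nodup_append.1 (R.legit ⟨c, hitems c hc, rfl⟩).nodup).2.1
  have hsq : ∀ c ∈ (st.commit P cfg e items).sequenced, K c := fun c hc =>
    ((hlocks.commit R.sound.digest_injective e hn).2.2 c hc).elim (hseq c) (hitems c)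
  rcases commit_cases P cfg e st items with
    ⟨-, he⟩ | ⟨-, st0, st1, st2, n, h0, h0c, h0d, h1, h2, h2c, h2d, he⟩
  · rw [he]
    exact ⟨l, fun _ h => h, hl', h.db_eq, hcv, h.sub, h.epoch⟩
  have hf := formCheckpoints_sameLocks (P := P) (st := st2) n
  rw [he] at hlock' hsq ⊢
  rw [hf.sharedLock] at hlock'
  rw [hf.sequenced] at hsq
  have hr := LockInv.receive R.sound.digest_injective (K := fun c => c ∈ certsOf items)
    (hlocks.congr (st' := st0) h0.sharedLock h0.nextShared) (fun c hc => hc) hn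
  rw [← h1] at hr
  have hrec : st2.records = st.records := by
    rw [SeqState.records, h2c, hr.checkpoints, h0c, SeqState.records]
  have hdb : st2.checkpointDB = st.checkpointDB := by rw [h2d, hr.checkpointDB, h0d]
  -- Invariant of the loop that forms checkpoints: locks and sequenced certificates are final, while
  -- the common trace may still grow.
  refine (formCheckpoints_induction (P := P) (st := st2) (M := fun s =>
    s.sharedLock = lock' ∧ (∀ c ∈ s.sequenced, K c) ∧ ∃ m, (∀ u ∈ l, u ∈ m) ∧
      Valid P lock' (fun tx => ∃ c, K c ∧ c.tx = tx) db m ∧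
      Checkpointed P e lock' (fun tx => ∃ c, K c ∧ c.tx = tx) db m s) ?_ n
    ⟨hlock'.symm, hsq, l, fun _ h => h, hl', ?_⟩).2.2
  · rintro s s' ⟨hs1, hs2, m, hm1, hm2, hm3⟩ hs'
    obtain ⟨hsame, k, pending, targets, hp, hcp, hcd⟩ := formCheckpoint_cases hs'
    refine ⟨hsame.sharedLock.trans hs1, hsame.sequenced ▸ hs2, ?_⟩
    rw [hs1, hm3.db_eq] at hcp hcd
    obtain ⟨m', h3, h4, h5, h6⟩ := absorb_executeReady R hG k (pending := pending)
      (fun c hc => (hK c (hs2 c (hp c hc))).2.mono hm1) (fun c hc => ⟨c, hs2 c (hp c hc), rfl⟩)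
      hm2 hm3.valid hm3.sub
    revert hcp hcd h5 h6
    generalize hrecs : executeReady P lock' k _ pending = recs
    intro hcp hcd h5 h6
    have hrec' : s'.records = s.records ++ causalPast targets recs := by
      simp [SeqState.records, hcp]
    obtain ⟨-, h7⟩ := valid_append.1 h5
    have h8 := h7.causalPast R (hm3.valid.good R hG) targets
    refine ⟨m', fun u hu => h3 u (hm1 u hu), h4, ⟨?_, ?_, ?_, ?_⟩⟩
    · rw [hcd, hrec', List.map_append, after_append, after_map_bare _ (causalPast _ _)]
    · rw [hrec', List.map_append, causalPast_map_bare]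
      exact valid_append.2 ⟨hm3.valid, h8⟩
    · intro r hr
      rw [hrec', List.map_append, List.mem_append, causalPast_map_bare] at hr
      rcases hr with hr | hr
      · exact h3 r (hm3.sub r hr)
      · exact h6 r (mem_of_mem_causalPast hr)
    · intro r hr
      rw [hrec', List.mem_append] at hr
      rcases hr with hr | hr
      · exact hm3.epoch r hr
      · have := mem_of_mem_causalPast hr
        rw [← hrecs] at this
        exact (hK _ (hs2 _ (hp _ (executeReady_subset this)))).1
  · exact ⟨by rw [hdb, hrec, h.db_eq], by rw [hrec]; exact hcv, by rw [hrec]; exact h.sub,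
      by rw [hrec]; exact h.epoch⟩

end checkpoints

/-! ## The run of the system seen from one epoch -/

/-- The part of the global state that concerns one epoch. -/
structure View (C : Sorts.{u}) : Type u where
  loc : C.Val → Option (Local C)
  log : List (Commit C)
  signed : C.Val → Tx C → Prop

/-- A genuine certificate of epoch `e`. -/
def View.Certified (cfg : Config C) (e : ℕ) (V : View C) (c : Cert C) : Prop :=
  c.epoch = e ∧ cfg.IsQuorum e c.signers ∧ ∀ p ∈ c.signers, p ∈ cfg.faulty e ∨ V.signed p c.tx

def View.CertifiedTx (cfg : Config C) (e : ℕ) (V : View C) (tx : Tx C) : Prop :=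
  ∃ c, V.Certified cfg e c ∧ c.tx = tx

/-- An entry of the certificate map without the signers of the certificate. -/
def anonymous (x : Option (Cert C × Effects C)) : Option ((Tx C × ℕ) × Effects C) :=
  x.map (fun x => ((x.1.tx, x.1.epoch), x.2))

/-- Equality of stores, whoever signed the certificates. -/
structure Persistent.Same (X S : Persistent C) : Prop where
  objDB : X.objDB = S.objDB
  nextShared : X.nextShared = S.nextShared
  ct : ∀ d, anonymous (X.ct d) = anonymous (S.ct d)

/-- The steps of the system in epoch `e`, where validators enter with the stores `S`. -/
inductive EpochStep (P : Platform C) (cfg : Config C) (e : ℕ) (S : Persistent C) :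
    View C → View C → Prop where
  | sign {V : View C} (v : C.Val) (L : Local C) (tx : Tx C) (loc : V.loc v = some L)
      (checks : L.Signable P tx) :
      EpochStep P cfg e S V
        { V with
          loc := Function.update V.loc v (some (L.lock tx))
          signed := fun w t => V.signed w t ∨ (w = v ∧ t = tx) }
  | exec {V : View C} (v : C.Val) (L : Local C) (c : Cert C) (r : Record C)
      (loc : V.loc v = some L) (certified : V.Certified cfg e c)
      (executed : execute P L.seq.sharedLock L.objDB c = some r) :
      EpochStep P cfg e S V { V with loc := Function.update V.loc v (some (L.persist r)) }
  | consensus {V : View C} (items : Commit C)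
      (certified : ∀ c ∈ certsOf items, V.Certified cfg e c) :
      EpochStep P cfg e S V { V with log := V.log ++ [items] }
  | commit {V : View C} (v : C.Val) (L : Local C) (items : Commit C) (loc : V.loc v = some L)
      (next : V.log[L.seq.history.length]? = some items) :
      EpochStep P cfg e S V
        { V with
          loc := Function.update V.loc v (some { L with seq := L.seq.commit P cfg e items }) }
  | close {V : View C} (v : C.Val) (L : Local C) (loc : V.loc v = some L) :
      EpochStep P cfg e S V
        { V with loc := Function.update V.loc v (some { L with closing := true }) }
  | enter {V : View C} (v : C.Val) (X : Persistent C) (loc : V.loc v = none) (same : X.Same S) :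
      EpochStep P cfg e S V { V with loc := Function.update V.loc v (some X.enter) }

/-- The executions of a validator in the epoch, in order. -/
def Local.trace (L : Local C) : List (Record C) := L.journal.reverse.map Record.bare

/-- The digests of the transactions executed in earlier epochs. -/
def Persistent.domain (S : Persistent C) : Set C.Digest := {d | S.ct d ≠ none}

/-- The state derived from the commits of epoch `e`. -/
def seqOf (P : Platform C) (cfg : Config C) (e : ℕ) (S : Persistent C)
    (log : List (Commit C)) : SeqState C :=
  log.foldl (SeqState.commit P cfg e) (.fresh S.objDB S.nextShared)

/-- The object `k` is locked for `tx` and in the store. -/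
def Local.Held (L : Local C) (k : ObjKey C) (tx : Tx C) : Prop :=
  L.ownedLock k = some tx ∧ ∃ o, L.objDB k.1 = some o ∧ o.version ≠ 0 ∧ o.key = k

structure LocalInv (P : Platform C) (cfg : Config C) (e : ℕ) (S : Persistent C)
    (V : View C) (l : List (Record C)) (L : Local C) : Prop where
  seq_eq : L.seq = seqOf P cfg e S L.seq.history
  history : L.seq.history <+: V.log
  valid : Valid P (seqOf P cfg e S V.log).sharedLock (V.CertifiedTx cfg e) S.objDB L.trace
  sub : ∀ r ∈ L.trace, r ∈ l
  db_eq : L.objDB = S.objDB.after L.trace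
  ct : ∃ ct0 : CertMap C, (∀ d, anonymous (ct0 d) = anonymous (S.ct d)) ∧
    L.ct = L.journal.foldr (fun r ct => ct.add r) ct0
  epoch : ∀ r ∈ L.journal, r.cert.epoch = e

/-- The invariant of epoch `e`: all executions are part of the trace `l`. -/
structure EpochInv (P : Platform C) (cfg : Config C) (e : ℕ) (S : Persistent C)
    (V : View C) (l : List (Record C)) : Prop where
  valid : Valid P (seqOf P cfg e S V.log).sharedLock (V.CertifiedTx cfg e) S.objDB l
  legit : ∀ {v tx}, V.signed v tx → tx.Legit
  owned : ∀ {v tx}, V.signed v tx → OwnedInputs S.objDB l tx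
  unique : ∀ {v tx tx' k}, V.signed v tx → V.signed v tx' → k ∈ tx.inputs → k ∈ tx'.inputs →
    tx = tx'
  held : ∀ {v tx}, V.signed v tx → ∃ L, V.loc v = some L ∧ ∀ k ∈ tx.inputs,
    L.Held k tx ∨ Dead P (executed S.domain L.trace) L.objDB k
  certs : AllCerts (V.Certified cfg e) V.log
  checkpointed : Checkpointed P e (seqOf P cfg e S V.log).sharedLock (V.CertifiedTx cfg e)
    S.objDB l (seqOf P cfg e S V.log)
  locals : ∀ {v L}, V.loc v = some L → LocalInv P cfg e S V l L

/-! ## Quorums -/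

/-- Two sets with more than two thirds of the stake each overlap in more than one third, which
cannot be faulty throughout. -/
theorem Config.BFT.exists_correct {cfg : Config C} (h : cfg.BFT) {e : ℕ} {A B : Finset C.Val}
    (hA : cfg.IsQuorum e A) (hB : cfg.IsQuorum e B) : ∃ p ∈ A, p ∈ B ∧ p ∉ cfg.faulty e := by
  by_contra hno
  push Not at hno
  have h1 := h e (A ∩ B) (Finset.inter_subset_left.trans hA.1) fun v hv =>
    hno v (Finset.mem_inter.1 hv).1 (Finset.mem_inter.1 hv).2
  have h2 : cfg.stakeOf e (A ∪ B) + cfg.stakeOf e (A ∩ B) = cfg.stakeOf e A + cfg.stakeOf e B :=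
    Finset.sum_union_inter
  have h3 : cfg.stakeOf e (A ∪ B) ≤ cfg.stakeOf e (cfg.committee e) :=
    Finset.sum_le_sum_of_subset (Finset.union_subset hA.1 hB.1)
  have h4 := hA.2
  have h5 := hB.2
  omega

/-- Reduces rules about certified transactions to the conduct of a single correct signer. Applied to
one transaction twice, it produces a correct signer of it. -/
theorem View.CertifiedTx.exists_signed {cfg : Config C} (h : cfg.BFT) {e : ℕ} {V : View C}
    {tx tx' : Tx C} (ht : V.CertifiedTx cfg e tx) (ht' : V.CertifiedTx cfg e tx') :
    ∃ p, V.signed p tx ∧ V.signed p tx' := by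
  obtain ⟨c, ⟨-, hq, hs⟩, rfl⟩ := ht
  obtain ⟨c', ⟨-, hq', hs'⟩, rfl⟩ := ht'
  obtain ⟨p, hp, hp', hf⟩ := h.exists_correct hq hq'
  exact ⟨p, (hs p hp).resolve_left hf, (hs' p hp').resolve_left hf⟩

/-! ### What the epoch invariant implies for certified transactions and locks. -/

section invariant
variable {P : Platform C} {cfg : Config C} {e : ℕ} {S : Persistent C} {V V' : View C}
  {l l' : List (Record C)}

/-- The lock table is left free because a new commit is absorbed under the locks of the extended
log, for which the invariant is not yet available. -/
theorem EpochInv.rules_of_lock (h : EpochInv P cfg e S V l) (sound : P.Sound) (bft : cfg.BFT)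
    {lock : SharedLock C}
    (hlock : ∀ {d d' i n}, lock d i = some n → lock d' i = some n → d = d') :
    Rules P lock (V.CertifiedTx cfg e) where
  sound := sound
  legit ht := let ⟨_, hp, _⟩ := ht.exists_signed bft ht; h.legit hp
  key_unique ht ht' hk hk' := let ⟨_, hp, hp'⟩ := ht.exists_signed bft ht'; h.unique hp hp' hk hk'
  lock_unique := hlock

theorem EpochInv.nodup (h : EpochInv P cfg e S V l) (bft : cfg.BFT) {c : Cert C}
    (hc : V.Certified cfg e c) : (c.tx.shared.map Prod.fst).Nodup := by
  have ht : V.CertifiedTx cfg e c.tx := ⟨c, hc, rfl⟩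
  obtain ⟨p, hp, -⟩ := ht.exists_signed bft ht
  exact (List.nodup_append.1 (h.legit hp).nodup).2.1

theorem EpochInv.lockInv (h : EpochInv P cfg e S V l) (sound : P.Sound) (bft : cfg.BFT)
    {log : List (Commit C)} (hlog : AllCerts (V.Certified cfg e) log) :
    LockInv P (seqOf P cfg e S log) ∧
      ∀ c ∈ (seqOf P cfg e S log).sequenced, V.Certified cfg e c := by
  obtain ⟨h1, -, h3⟩ := LockInv.foldl_commit (cfg := cfg) sound.digest_injective e
    (fun c hc => h.nodup bft hc) (lockInv_fresh P S.objDB S.nextShared) hlog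
  exact ⟨h1, fun c hc => (h3 c hc).resolve_left (by simp [SeqState.fresh])⟩

theorem EpochInv.rules (h : EpochInv P cfg e S V l) (sound : P.Sound) (bft : cfg.BFT) :
    Rules P (seqOf P cfg e S V.log).sharedLock (V.CertifiedTx cfg e) :=
  h.rules_of_lock sound bft (h.lockInv sound bft h.certs).1.unique

theorem EpochInv.lockLe (h : EpochInv P cfg e S V l) (sound : P.Sound) (bft : cfg.BFT)
    {log log' : List (Commit C)} (hlog : AllCerts (V.Certified cfg e) log') (hp : log <+: log') :
    LockLe (seqOf P cfg e S log).sharedLock (seqOf P cfg e S log').sharedLock := by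
  obtain ⟨m, rfl⟩ := hp
  have h1 := (h.lockInv sound bft (log := log) fun a ha => hlog a (by simp [ha])).1
  have h2 := (LockInv.foldl_commit (cfg := cfg) sound.digest_injective e
    (fun c hc => h.nodup bft hc) h1 (log := m) fun a ha => hlog a (by simp [ha])).2.1
  rw [seqOf, seqOf, List.foldl_append]
  exact h2

theorem EpochInv.ownedInputs (h : EpochInv P cfg e S V l) (bft : cfg.BFT) {tx : Tx C}
    (ht : V.CertifiedTx cfg e tx) : OwnedInputs S.objDB l tx :=
  let ⟨_, hp, _⟩ := ht.exists_signed bft ht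
  h.owned hp

theorem LocalInv.mono {L : Local C} (h : LocalInv P cfg e S V l L) (hl : ∀ r ∈ l, r ∈ l')
    (hlock : LockLe (seqOf P cfg e S V.log).sharedLock (seqOf P cfg e S V'.log).sharedLock)
    (hlog : V.log <+: V'.log) (hs : ∀ tx, V.CertifiedTx cfg e tx → V'.CertifiedTx cfg e tx) :
    LocalInv P cfg e S V' l' L :=
  ⟨h.seq_eq, h.history.trans hlog, h.valid.mono hlock hs, fun r hr => hl r (h.sub r hr), h.db_eq,
    h.ct, h.epoch⟩

theorem Checkpointed.mono {lock : SharedLock C} {Q Q' : Tx C → Prop} {db : ObjDB C}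
    {st : SeqState C} (h : Checkpointed P e lock Q db l st) (hl : ∀ r ∈ l, r ∈ l')
    (hs : ∀ tx, Q tx → Q' tx) : Checkpointed P e lock Q' db l' st :=
  ⟨h.db_eq, h.valid.mono (fun _ _ _ h => h) hs, fun r hr => hl r (h.sub r hr), h.epoch⟩

theorem LocalInv.good {L : Local C} (h : LocalInv P cfg e S V l L)
    (R : Rules P (seqOf P cfg e S V.log).sharedLock (V.CertifiedTx cfg e))
    (hG : Good P S.objDB S.domain) : Good P L.objDB (executed S.domain L.trace) := by
  rw [h.db_eq]
  exact h.valid.good R hG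

end invariant

section preservation
variable {P : Platform C} {cfg : Config C} {e : ℕ} {S : Persistent C} {V V' : View C}
  {l l' : List (Record C)}

/-! ## Preservation of the invariant -/

/-- Frame lemma for the steps that change one local state and neither the log nor the signatures. -/
theorem EpochInv.update (h : EpochInv P cfg e S V l) (hl : ∀ r ∈ l, r ∈ l')
    (hv : Valid P (seqOf P cfg e S V.log).sharedLock (V.CertifiedTx cfg e) S.objDB l')
    {v : C.Val} {L' : Local C} (hL : LocalInv P cfg e S V l' L')
    (held : ∀ tx, V.signed v tx → ∀ k ∈ tx.inputs,
      L'.Held k tx ∨ Dead P (executed S.domain L'.trace) L'.objDB k) :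
    EpochInv P cfg e S { V with loc := Function.update V.loc v (some L') } l' where
  valid := hv
  legit := h.legit
  owned ht := (h.owned ht).mono hl
  unique := h.unique
  held {w tx} ht := by
    by_cases hw : w = v
    · subst hw
      exact ⟨L', by simp, held tx ht⟩
    · obtain ⟨L, hL, h'⟩ := h.held ht
      exact ⟨L, by simpa [hw] using hL, h'⟩
  certs := h.certs
  checkpointed := h.checkpointed.mono hl fun _ h => h
  locals {w L} hloc := by
    by_cases hw : w = v
    · subst hw
      simp only [Function.update_self, Option.some.injEq] at hloc
      subst hloc
      exact hL.mono (fun _ h => h) (fun _ _ _ h => h) (List.prefix_refl _) fun _ h => h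
    · simp only [Function.update_of_ne hw] at hloc
      exact (h.locals hloc).mono hl (fun _ _ _ h => h) (List.prefix_refl _) fun _ h => h

theorem EpochInv.held_of_loc (h : EpochInv P cfg e S V l) {v : C.Val} {L : Local C}
    (loc : V.loc v = some L) {tx : Tx C} (ht : V.signed v tx) {k : ObjKey C}
    (hk : k ∈ tx.inputs) :
    L.Held k tx ∨ Dead P (executed S.domain L.trace) L.objDB k := by
  obtain ⟨L', hL', h'⟩ := h.held ht
  rw [loc] at hL'
  cases hL'
  exact h' k hk

theorem not_dead_of_live {D : Set C.Digest} {db : ObjDB C} {o : Obj C} {i : C.ObjID}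
    (ho : db i = some o) (hv : o.version ≠ 0) : ¬ Dead P D db o.key :=
  fun h => lt_irrefl _ (h.2 i o ho hv (P.id_mem_ids o))

/-- The signer finds every owned input live, so no input key is dead. By `held`, an earlier
transaction that it signed with one of these keys still has the lock, and the lock check makes the
two transactions equal. -/
theorem EpochInv.step_sign (h : EpochInv P cfg e S V l) (sound : P.Sound) (bft : cfg.BFT)
    (hG : Good P S.objDB S.domain) {v : C.Val} {L : Local C} {tx : Tx C}
    (loc : V.loc v = some L) (checks : L.Signable P tx) :
    EpochInv P cfg e S
      { V with
        loc := Function.update V.loc v (some (L.lock tx))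
        signed := fun w t => V.signed w t ∨ (w = v ∧ t = tx) } l := by
  have hQ : ∀ t, V.CertifiedTx cfg e t → View.CertifiedTx cfg e
      { V with
        loc := Function.update V.loc v (some (L.lock tx))
        signed := fun w t => V.signed w t ∨ (w = v ∧ t = tx) } t := by
    rintro t ⟨c, ⟨h1, h2, h3⟩, rfl⟩
    exact ⟨c, ⟨h1, h2, fun p hp => (h3 p hp).imp_right .inl⟩, rfl⟩
  have hL := h.locals loc
  have hGL := hL.good (h.rules sound bft) hG
  obtain ⟨⟨objs, hload, hvalid⟩, -, -, hlocks⟩ := checks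
  have hload' := loadOwned_iff.1 hload
  have hin : ∀ k ∈ tx.inputs, ∃ o ∈ objs, L.objDB k.1 = some o ∧ o.version ≠ 0 ∧ o.key = k := by
    intro k hk
    obtain ⟨o, ho, h1, h2, h3⟩ := forall₂_exists_of_mem_left hload' hk
    exact ⟨o, ho, h1, h2, Prod.ext (hGL.id_eq h1) h3⟩
  have hnd : ∀ k ∈ tx.inputs, ¬ Dead P (executed S.domain L.trace) L.objDB k := by
    intro k hk
    obtain ⟨o, -, h1, h2, rfl⟩ := hin k hk
    exact not_dead_of_live h1 h2
  have huniq : ∀ t k, V.signed v t → k ∈ t.inputs → k ∈ tx.inputs → t = tx := by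
    intro t k ht hk hk'
    have h1 := ((h.held_of_loc loc ht hk).resolve_right (hnd k hk')).1
    rcases hlocks k hk' with h2 | h2 <;> rw [h1] at h2 <;> cases h2
    rfl
  refine ⟨h.valid.mono (fun _ _ _ h => h) hQ, ?_, ?_, ?_, ?_, ?_,
    h.checkpointed.mono (fun _ h => h) hQ, ?_⟩
  · rintro w t (ht | ⟨rfl, rfl⟩)
    · exact h.legit ht
    · exact ⟨hvalid.1, hvalid.2.1⟩
  · rintro w t (ht | ⟨rfl, rfl⟩)
    · exact h.owned ht
    · intro k hk
      obtain ⟨o, ho, h1, h2, h3⟩ := hin k hk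
      refine ⟨o, ?_, h3, ?_⟩
      · rw [hL.db_eq] at h1
        exact (hist_of_after (fun _ _ => hG.id_eq) h1 h2).mono hL.sub
      · have := hvalid.2.2.1 o ho
        cases hw : o.owner <;> simp_all [Owner.isOwned]
  · rintro w t t' k (ht | ⟨rfl, rfl⟩) (ht' | ⟨hw, rfl⟩) hk hk'
    · exact h.unique ht ht' hk hk'
    · subst hw
      exact huniq t k ht hk hk'
    · exact (huniq t' k ht' hk' hk).symm
    · rfl
  · rintro w t ht
    by_cases hw : w = v
    · subst hw
      refine ⟨L.lock tx, by simp, fun k hk => ?_⟩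
      by_cases hk' : k ∈ tx.inputs
      · have : t = tx := by
          rcases ht with ht | ⟨-, rfl⟩
          · exact huniq t k ht hk hk'
          · rfl
        subst this
        obtain ⟨o, -, h1, h2, h3⟩ := hin k hk
        exact .inl ⟨by simp [Local.lock, hk], o, h1, h2, h3⟩
      · rcases ht with ht | ⟨-, rfl⟩
        · refine (h.held_of_loc loc ht hk).imp_left fun hh => ⟨?_, hh.2⟩
          simpa [Local.lock, hk'] using hh.1
        · exact absurd hk hk'
    · have ht' : V.signed w t := ht.resolve_right fun h => hw h.1
      obtain ⟨L', hL', h'⟩ := h.held ht'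
      exact ⟨L', by simpa [hw] using hL', h'⟩
  · intro items hi c hc
    obtain ⟨h1, h2, h3⟩ := h.certs items hi c hc
    exact ⟨h1, h2, fun p hp => (h3 p hp).imp_right .inl⟩
  · intro w L' hloc
    by_cases hw : w = v
    · subst hw
      simp only [Function.update_self, Option.some.injEq] at hloc
      subst hloc
      exact ⟨hL.seq_eq, hL.history, hL.valid.mono (fun _ _ _ h => h) hQ, hL.sub, hL.db_eq, hL.ct,
        hL.epoch⟩
    · simp only [Function.update_of_ne hw] at hloc
      exact (h.locals hloc).mono (fun _ h => h) (fun _ _ _ h => h) (List.prefix_refl _) hQ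

theorem Local.trace_persist (L : Local C) (r : Record C) :
    (L.persist r).trace = L.trace ++ [r.bare] := by
  simp [Local.trace, Local.persist]

theorem EpochInv.step_exec (h : EpochInv P cfg e S V l) (sound : P.Sound) (bft : cfg.BFT)
    (hG : Good P S.objDB S.domain) {v : C.Val} {L : Local C} {c : Cert C} {r : Record C}
    (loc : V.loc v = some L) (certified : V.Certified cfg e c)
    (executed' : execute P L.seq.sharedLock L.objDB c = some r) :
    ∃ m, EpochInv P cfg e S { V with loc := Function.update V.loc v (some (L.persist r)) } m := by
  have R := h.rules sound bft
  have hL := h.locals loc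
  have hGL := hL.good R hG
  have hQ : V.CertifiedTx cfg e c.tx := ⟨c, certified, rfl⟩
  -- The validator may lag behind the log, but its shared locks are among those of the whole log.
  have hle := h.lockLe sound bft h.certs hL.history
  rw [← hL.seq_eq] at hle
  have hx := execute_mono hle executed'
  obtain ⟨-, hcert⟩ := execute_bare hx
  have hx' := hx
  rw [hL.db_eq] at hx'
  obtain ⟨m, h1, h2, h3, h4⟩ := absorb_execution R hG h.valid hL.valid hL.sub
    (h.ownedInputs bft hQ) hQ hx'
  have hen : Enabled P (seqOf P cfg e S V.log).sharedLock (V.CertifiedTx cfg e) L.objDB r.bare := by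
    rw [hL.db_eq]
    exact (valid_append.1 h3).2.1
  refine ⟨m, h.update h1 h2 ⟨hL.seq_eq, hL.history, ?_, ?_, ?_, ?_, ?_⟩ ?_⟩
  · rw [L.trace_persist]; exact h3
  · rw [L.trace_persist]
    intro u hu
    rcases List.mem_append.1 hu with hu | hu
    · exact h1 u (hL.sub u hu)
    · rw [List.mem_singleton.1 hu]; exact h4
  · rw [L.trace_persist, after_append, ← hL.db_eq]; rfl
  · obtain ⟨ct0, hct, hct'⟩ := hL.ct
    exact ⟨ct0, hct, congrArg (fun ct => CertMap.add ct r) hct'⟩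
  · intro u hu
    rcases List.mem_cons.1 hu with rfl | hu
    · rw [hcert]; exact certified.1
    · exact hL.epoch u hu
  · intro tx ht k hk
    rw [L.trace_persist, executed_concat]
    -- A held key is either consumed, hence dead, or untouched. In the latter case the lock
    -- survives, since locks are opened only for keys of outputs and for owned inputs of the
    -- transaction.
    rcases h.held_of_loc loc ht hk with ⟨hlock, o, ho, hov, rfl⟩ | hd
    · by_cases hc : o ∈ r.consumed
      · exact .inr (hen.dead_of_consumed hGL (x := o) hc)
      · have hc' : o.id ∉ r.consumedIds := by
          intro hi
          obtain ⟨x, hx, hxo⟩ := List.mem_map.1 hi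
          have := (hen.consumed_in hGL (x := x) hx).1
          rw [hxo] at this
          rw [show L.objDB o.id = some o from ho] at this
          cases this
          exact hc hx
        have hp : o.id ∉ r.producedIds := hen.notMem_producedIds R hGL (r := r.bare) ho hc'
        refine .inl ⟨?_, o, (apply_of_notMem hp hc').trans ho, hov, rfl⟩
        have hn1 : (r.produced.any (fun x => x.owner.isOwned && x.key == o.key)) = false := by
          rw [List.any_eq_false]
          intro x hx hxo
          simp only [Bool.and_eq_true, beq_iff_eq] at hxo
          exact hp (List.mem_map.2 ⟨x, hx, congrArg Prod.fst hxo.2⟩)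
        have hn2 : o.key ∉ r.cert.tx.inputs := by
          intro hi
          obtain ⟨x, hx, hxo⟩ := hen.input_in hGL (k := o.key) hi
          exact hc' (List.mem_map.2 ⟨x, hx, congrArg Prod.fst hxo⟩)
        simp only [Local.persist, hn1, hn2]
        simpa using hlock
    · exact .inr (hen.dead_step R hGL hd)

theorem seqOf_concat (P : Platform C) (cfg : Config C) (e : ℕ) (S : Persistent C)
    (log : List (Commit C)) (items : Commit C) :
    seqOf P cfg e S (log ++ [items]) = (seqOf P cfg e S log).commit P cfg e items := by
  simp [seqOf]

/-- The checkpoints of the whole log are part of the invariant, ahead of any validator. So the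
common trace may have to grow by transactions that no validator has executed yet. -/
theorem EpochInv.step_consensus (h : EpochInv P cfg e S V l) (sound : P.Sound) (bft : cfg.BFT)
    (hG : Good P S.objDB S.domain) {items : Commit C}
    (certified : ∀ c ∈ certsOf items, V.Certified cfg e c) :
    ∃ m, EpochInv P cfg e S { V with log := V.log ++ [items] } m := by
  have hlog : AllCerts (V.Certified cfg e) (V.log ++ [items]) := by
    intro a ha
    rcases List.mem_append.1 ha with ha | ha
    · exact h.certs a ha
    · rw [List.mem_singleton.1 ha]; exact certified
  have hle := h.lockLe sound bft hlog (List.prefix_append V.log [items])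
  have hinv := h.lockInv sound bft h.certs
  obtain ⟨m, h1, h2, h3⟩ := Checkpointed.commit (cfg := cfg) (items := items)
    (K := V.Certified cfg e) (congrArg _ (seqOf_concat P cfg e S V.log items)) hle
    (h.rules_of_lock sound bft (h.lockInv sound bft hlog).1.unique) hG hinv.1
    (fun c hc => ⟨hc.1, h.ownedInputs bft ⟨c, hc, rfl⟩⟩) hinv.2 certified h.valid h.checkpointed
  rw [← seqOf_concat] at h3
  exact ⟨m, h2, h.legit, fun ht => (h.owned ht).mono h1, h.unique, h.held, hlog, h3,
    fun hloc => (h.locals hloc).mono h1 hle (List.prefix_append _ _) fun _ h => h⟩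

theorem EpochInv.step_commit (h : EpochInv P cfg e S V l)
    {v : C.Val} {L : Local C} {items : Commit C} (loc : V.loc v = some L)
    (next : V.log[L.seq.history.length]? = some items) :
    EpochInv P cfg e S
      { V with
        loc := Function.update V.loc v (some { L with seq := L.seq.commit P cfg e items }) } l := by
  have hL := h.locals loc
  refine h.update (fun _ h => h) h.valid ?_ fun tx ht k hk => h.held_of_loc loc ht hk
  by_cases hd : L.seq.contract.phase = .done
  · rw [commit_of_done hd]; exact hL
  · have hh := commit_history P cfg e L.seq items hd
    refine ⟨?_, ?_, hL.valid, hL.sub, hL.db_eq, hL.ct, hL.epoch⟩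
    · show L.seq.commit P cfg e items = seqOf P cfg e S (L.seq.commit P cfg e items).history
      rw [hh, seqOf_concat, ← hL.seq_eq]
    · show (L.seq.commit P cfg e items).history <+: V.log
      rw [hh]
      -- The processed history is a prefix of the log, so the commit at the index of its length is
      -- the first of the unread rest.
      obtain ⟨m, hm⟩ := hL.history
      rw [← hm, List.getElem?_append_right (le_refl _), Nat.sub_self] at next
      cases m with
      | nil => simp at next
      | cons a m =>
        cases next
        exact ⟨m, by simpa using hm⟩

theorem Persistent.Same.localInv {X : Persistent C} (same : X.Same S) :
    LocalInv P cfg e S V l X.enter where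
  seq_eq := by
    show SeqState.fresh X.objDB X.nextShared = _
    rw [same.objDB, same.nextShared]; rfl
  history := List.nil_prefix
  valid := trivial
  sub r hr := by simp [Local.trace, Persistent.enter] at hr
  db_eq := same.objDB
  ct := ⟨X.ct, same.ct, rfl⟩
  epoch r hr := by simp [Persistent.enter] at hr

/-- By `held`, every recorded signature belongs to a validator that is already in the epoch; so a
newcomer enters without signatures and needs no locks. -/
theorem EpochInv.step_enter (h : EpochInv P cfg e S V l) {v : C.Val} {X : Persistent C}
    (loc : V.loc v = none) (same : X.Same S) :
    EpochInv P cfg e S { V with loc := Function.update V.loc v (some X.enter) } l := by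
  refine h.update (fun _ h => h) h.valid same.localInv fun tx ht => ?_
  obtain ⟨L, hL, -⟩ := h.held ht
  rw [loc] at hL
  cases hL

theorem EpochInv.step (h : EpochInv P cfg e S V l) (sound : P.Sound) (bft : cfg.BFT)
    (hG : Good P S.objDB S.domain) (hs : EpochStep P cfg e S V V') :
    ∃ m, EpochInv P cfg e S V' m := by
  cases hs with
  | sign v L tx loc checks => exact ⟨l, h.step_sign sound bft hG loc checks⟩
  | exec v L c r loc certified executed => exact h.step_exec sound bft hG loc certified executed
  | consensus items certified => exact h.step_consensus sound bft hG certified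
  | commit v L items loc next => exact ⟨l, h.step_commit loc next⟩
  | close v L loc =>
    have hL := h.locals loc
    exact ⟨l, h.update (fun _ h => h) h.valid
      ⟨hL.seq_eq, hL.history, hL.valid, hL.sub, hL.db_eq, hL.ct, hL.epoch⟩
      fun tx ht k hk => h.held_of_loc loc ht hk⟩
  | enter v X loc same => exact ⟨l, h.step_enter loc same⟩

/-! ## The end of the epoch -/

/-- The stores with which the epoch after `e` starts, given the commits of epoch `e`. -/
def nextStores (P : Platform C) (cfg : Config C) (e : ℕ) (S : Persistent C)
    (log : List (Commit C)) : Persistent C :=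
  { objDB := (seqOf P cfg e S log).checkpointDB.live
    ct := (seqOf P cfg e S log).records.foldl CertMap.add S.ct
    nextShared := (seqOf P cfg e S log).nextShared }

/-! ### Certificate map and rollback. -/

theorem digests_map_bare (l : List (Record C)) : digests (l.map Record.bare) = digests l := by
  simp [digests, Record.bare]

theorem foldl_add_of_notMem {ct : CertMap C} {d : C.Digest} (h : d ∉ digests l) :
    l.foldl CertMap.add ct d = ct d := by
  induction l generalizing ct with
  | nil => rfl
  | cons r l ih =>
    simp only [digests, List.map_cons, List.mem_cons, not_or] at h
    rw [List.foldl_cons, ih h.2, CertMap.add, Function.update_of_ne h.1]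

theorem foldl_add_of_mem {ct : CertMap C} (hn : (digests l).Nodup) {r : Record C} (h : r ∈ l) :
    l.foldl CertMap.add ct r.effects.tx = some (r.cert, r.effects) := by
  induction l generalizing ct with
  | nil => simp at h
  | cons u l ih =>
    rw [digests, List.map_cons, List.nodup_cons] at hn
    rw [List.foldl_cons]
    rcases List.mem_cons.1 h with rfl | h
    · rw [foldl_add_of_notMem hn.1, CertMap.add, Function.update_self]
    · exact ih hn.2 h

theorem foldl_remove (ct : CertMap C) (d : C.Digest) :
    l.foldl CertMap.remove ct d = if d ∈ digests l then none else ct d := by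
  induction l generalizing ct with
  | nil => simp [digests]
  | cons r l ih =>
    rw [List.foldl_cons, ih]
    by_cases hd : d = r.effects.tx <;> simp [digests, CertMap.remove, hd]

theorem Local.rollback_eq (L : Local C) : L.rollback =
    ((without L.seq.included L.journal).foldl ObjDB.undo L.objDB,
      (without L.seq.included L.journal).foldl CertMap.remove L.ct) := by
  unfold Local.rollback
  generalize L.objDB = db
  generalize L.ct = ct
  induction L.journal generalizing db ct with
  | nil => rfl
  | cons r l ih =>
    rw [List.foldl_cons]
    by_cases hr : r.effects.tx ∈ L.seq.included
    · rw [if_pos hr, ih]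
      simp [without, hr]
    · rw [if_neg hr, ih]
      simp [without, hr]

/-- The certificate map of the full node records exactly the earlier transactions and the
checkpointed ones. A transaction that was rolled back is not in it and may be executed in a later
epoch. -/
theorem EpochInv.good_next (h : EpochInv P cfg e S V l) (sound : P.Sound) (bft : cfg.BFT)
    (hG : Good P S.objDB S.domain) :
    Good P (nextStores P cfg e S V.log).objDB (nextStores P cfg e S V.log).domain := by
  have R := h.rules sound bft
  have hc := h.checkpointed
  have h1 := (hc.valid.good R hG).live
  rw [← hc.db_eq] at h1
  have hn := hc.valid.nodup R hG
  rw [digests_map_bare] at hn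
  have : (nextStores P cfg e S V.log).domain =
      executed S.domain ((seqOf P cfg e S V.log).records.map Record.bare) := by
    ext d
    simp only [Persistent.domain, nextStores, executed, digests_map_bare, Set.mem_ofPred_eq,
      Set.mem_union]
    by_cases hd : d ∈ digests (seqOf P cfg e S V.log).records
    · obtain ⟨r, hr, rfl⟩ := mem_digests.1 hd
      simp [foldl_add_of_mem hn hr, hd]
    · simp [foldl_add_of_notMem hd, hd]
  rw [this]
  exact h1

/-- The executions to be rolled back are interleaved with checkpointed ones. By `Valid.residual`, in
their given order they also form a trace from the checkpointed store to the store of the validator;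
undoing this trace backwards returns to the checkpointed store. -/
theorem EpochInv.carryOver_same (h : EpochInv P cfg e S V l) (sound : P.Sound) (bft : cfg.BFT)
    (hG : Good P S.objDB S.domain) {v : C.Val} {L : Local C} (loc : V.loc v = some L)
    (phase : L.seq.contract.phase = .done)
    (all_executed : ∀ d ∈ L.seq.included, ∃ r ∈ L.journal, r.effects.tx = d) :
    (seqOf P cfg e S V.log).contract.phase = .done ∧
      L.carryOver.Same (nextStores P cfg e S V.log) := by
  have R := h.rules sound bft
  have hL := h.locals loc
  have hc := h.checkpointed
  -- Commits after the handover are ignored, so a validator that has processed the handover has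
  -- derived the state of the whole log.
  have hseq : seqOf P cfg e S V.log = L.seq := by
    obtain ⟨m, hm⟩ := hL.history
    rw [← hm, seqOf, List.foldl_append]
    change m.foldl _ (seqOf P cfg e S L.seq.history) = _
    rw [← hL.seq_eq, foldl_commit_of_done phase]
  refine ⟨hseq ▸ phase, ?_⟩
  unfold nextStores
  rw [hseq] at hc R ⊢
  have hvL := hL.valid
  have hvl := h.valid
  rw [hseq] at hvL hvl
  have hinc : L.seq.included = digests (L.seq.records.map Record.bare) :=
    (digests_map_bare _).symm
  have hmem : ∀ {r}, r ∈ L.journal → r.bare ∈ L.trace := fun hr =>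
    List.mem_map_of_mem (List.mem_reverse.2 hr)
  -- The digest of a checkpointed record has been executed by the validator. Both records lie in the
  -- common trace, where digests do not repeat, so they coincide, effects included.
  have hsub : ∀ b ∈ L.seq.records.map Record.bare, b ∈ L.trace := by
    intro b hb
    obtain ⟨r, hr, he⟩ := all_executed b.effects.tx (hinc ▸ mem_digests.2 ⟨b, hb, rfl⟩)
    rw [hvl.eq_of_digest_eq R hG (hc.sub b hb) (hL.sub _ (hmem hr)) he.symm]
    exact hmem hr
  obtain ⟨h1, h2⟩ := hc.valid.residual R hG hvL hsub
  have hw : without (digests (L.seq.records.map Record.bare)) L.trace =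
      (without L.seq.included L.journal).reverse.map Record.bare := by
    simp only [Local.trace, without, ← hinc, List.filter_map, List.filter_reverse]
    rfl
  have h3 := h1.undo R (hc.valid.good R hG)
  rw [h2, ← hL.db_eq, hw, ← List.map_reverse, List.reverse_reverse, List.foldl_map,
    ← hc.db_eq] at h3
  have hdb : L.rollback.1 = L.seq.checkpointDB := by
    rw [L.rollback_eq]; exact h3
  refine ⟨congrArg ObjDB.live hdb, rfl, fun d => ?_⟩
  change anonymous (L.rollback.2 d) = anonymous (L.seq.records.foldl CertMap.add S.ct d)
  obtain ⟨ct0, hct0, hct⟩ := hL.ct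
  have hnB := hc.valid.nodup R hG
  rw [digests_map_bare] at hnB
  have hrev : L.journal.foldr (fun r ct => CertMap.add ct r) ct0 =
      L.journal.reverse.foldl CertMap.add ct0 := by
    rw [List.foldl_reverse]
  have hnA := hvL.nodup R hG
  rw [Local.trace, digests_map_bare] at hnA
  rw [L.rollback_eq]
  simp only [foldl_remove, hct, hrev]
  -- A checkpointed digest has an entry of this epoch on both sides, from the same bare record. A
  -- digest rolled back has no entry on either side, as it was not executed in earlier epochs. All
  -- others keep their old entries.
  by_cases hd : d ∈ L.seq.included
  · obtain ⟨r, hr, rfl⟩ := all_executed d hd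
    rw [hinc, digests_map_bare] at hd
    obtain ⟨b, hb, he⟩ := mem_digests.1 hd
    have hbr : b.bare = r.bare := hvl.eq_of_digest_eq R hG
      (hc.sub _ (List.mem_map_of_mem hb)) (hL.sub _ (hmem hr)) he
    rw [if_neg, foldl_add_of_mem hnA (List.mem_reverse.2 hr), ← he, foldl_add_of_mem hnB hb]
    · have h4 : b.cert.tx = r.cert.tx := congrArg (fun x => x.cert.tx) hbr
      have h5 : b.effects = r.effects := congrArg (fun x => x.effects) hbr
      simp [anonymous, h4, h5, hc.epoch b hb, hL.epoch r hr]
    · intro hm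
      obtain ⟨x, hx, hxe⟩ := mem_digests.1 hm
      refine (mem_without.1 hx).2 ?_
      rw [hxe, hinc, digests_map_bare]
      exact hd
  · have hd' : d ∉ digests L.seq.records := hd
    rw [foldl_add_of_notMem hd']
    by_cases hj : d ∈ digests L.journal
    · obtain ⟨r, hr, rfl⟩ := mem_digests.1 hj
      rw [if_pos (mem_digests.2 ⟨r, mem_without.2 ⟨hr, hd⟩, rfl⟩)]
      have : S.ct r.effects.tx = none :=
        not_not.1 (hvL.notMem R hG (r := r.bare) (hmem hr))
      rw [this]
    · have hr : d ∉ digests L.journal.reverse := by simpa [digests] using hj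
      have hwo : d ∉ digests (without L.seq.included L.journal) := fun hm => by
        obtain ⟨x, hx, hxe⟩ := mem_digests.1 hm
        exact hj (mem_digests.2 ⟨x, (mem_without.1 hx).1, hxe⟩)
      rw [if_neg hwo, foldl_add_of_notMem hr, hct0]

end preservation

section runs
variable {P : Platform C} {cfg : Config C} {g g' : Global C} {σ : ℕ → Global C} {e : ℕ}
  {S : Persistent C}

/-! ## From the run to the epochs -/

/-- The view of epoch `e`. -/
def Global.view (g : Global C) (e : ℕ) : View C :=
  { loc := fun v => g.loc v e, log := g.log e, signed := fun v => g.signed v e }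

theorem setLoc_loc (g : Global C) (v w : C.Val) (e k : ℕ) (L : Local C) :
    (g.setLoc v e L).loc w k = if w = v ∧ k = e then some L else g.loc w k := by
  by_cases hw : w = v
  · subst hw
    by_cases hk : k = e <;> simp [Global.setLoc, hk]
  · simp [Global.setLoc, hw]

theorem view_setLoc (g : Global C) (v : C.Val) (e : ℕ) (L : Local C) :
    (g.setLoc v e L).view e =
      { g.view e with loc := Function.update (g.view e).loc v (some L) } := by
  have : (fun w => (g.setLoc v e L).loc w e) =
      Function.update (fun w => g.loc w e) v (some L) := by
    funext w
    rw [setLoc_loc, Function.update_apply]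
    simp
  simp only [Global.view, this]
  rfl

theorem view_setLoc_of_ne (g : Global C) (v : C.Val) {e k : ℕ} (h : k ≠ e) (L : Local C) :
    (g.setLoc v e L).view k = g.view k := by
  have : (fun w => (g.setLoc v e L).loc w k) = fun w => g.loc w k := by
    funext w
    rw [setLoc_loc, if_neg fun h' => h h'.2]
  simp only [Global.view, this]
  rfl

theorem Global.Genuine.certified {c : Cert C} (h : g.Genuine cfg c) (he : c.epoch = e) :
    (g.view e).Certified cfg e c := by
  subst he
  exact ⟨rfl, h⟩

/-- Every step of the system is a step of epoch `e` or does not concern epoch `e`. -/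
theorem Step.view (h : Step P cfg g g') (e : ℕ) (S : Persistent C)
    (entry : ∀ v L, g.loc v e = none → g'.loc v e = some L →
      ∃ X : Persistent C, X.Same S ∧ L = X.enter) :
    g'.view e = g.view e ∨ EpochStep P cfg e S (g.view e) (g'.view e) := by
  cases h with
  | processTx v k L tx active not_paused checks =>
    by_cases hk : e = k
    · subst hk
      right
      have := EpochStep.sign (P := P) (cfg := cfg) (e := e) (S := S) (V := g.view e) v L tx
        active.2.1 checks
      convert this using 1
      have h1 := congrArg View.loc (view_setLoc g v e (L.lock tx))
      simp only [Global.view] at h1 ⊢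
      simp only [h1, true_and]
      rfl
    · left
      have h1 := congrArg View.loc (view_setLoc_of_ne g v hk (L.lock tx))
      simp only [Global.view] at h1 ⊢
      simp only [h1, hk, false_and, and_false, or_false]
      rfl
  | processCert v k L c r active epoch genuine accepted executed =>
    by_cases hk : e = k
    · subst hk
      rw [view_setLoc]
      exact .inr (.exec v L c r active.2.1 (genuine.certified epoch) executed)
    · exact .inl (view_setLoc_of_ne g v hk _)
  | consensus k items authentic =>
    by_cases hk : e = k
    · subst hk
      right
      have := EpochStep.consensus (P := P) (S := S) (V := g.view e) items fun c hc =>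
        have h' := authentic _ (mem_certsOf.1 hc)
        Global.Genuine.certified (g := g) (cfg := cfg) h'.2 h'.1
      convert this using 1
      simp [Global.view]
    · left
      simp [Global.view, hk]
  | processCommit v k L items active next =>
    by_cases hk : e = k
    · subst hk
      rw [view_setLoc]
      exact .inr (.commit v L items active.2.1 next)
    · exact .inl (view_setLoc_of_ne g v hk _)
  | endOfEpoch v k L active phase all_sequenced =>
    by_cases hk : e = k
    · subst hk
      rw [view_setLoc]
      exact .inr (.close v L active.2.1)
    · exact .inl (view_setLoc_of_ne g v hk _)
  -- A handover out of epoch `k` writes only the local state of epoch `k + 1`.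
  | handover v k L active next_committee phase all_executed =>
    by_cases hk : e = k + 1
    · subst hk
      obtain ⟨X, hX, he⟩ := entry v L.carryOver.enter active.2.2 (by simp [setLoc_loc])
      rw [view_setLoc, he]
      exact .inr (.enter v X active.2.2 hX)
    · exact .inl (view_setLoc_of_ne g v hk _)
  | join v k X next_committee new not_entered synchronised =>
    by_cases hk : e = k + 1
    · subst hk
      obtain ⟨Y, hY, he⟩ := entry v X.enter not_entered (by simp [setLoc_loc])
      rw [view_setLoc, he]
      exact .inr (.enter v Y not_entered hY)
    · exact .inl (view_setLoc_of_ne g v hk _)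

/-- How a validator enters an epoch. -/
theorem Step.entry (h : Step P cfg g g') {v : C.Val} {L : Local C} (hn : g.loc v e = none)
    (hs : g'.loc v e = some L) :
    ∃ k, e = k + 1 ∧ ((∃ L0, g.loc v k = some L0 ∧ L0.seq.contract.phase = .done ∧
        (∀ d ∈ L0.seq.included, ∃ r ∈ L0.journal, r.effects.tx = d) ∧ L = L0.carryOver.enter) ∨
      ∃ X, fullNode P cfg g.log e = some X ∧ L = X.enter) := by
  -- A step that rewrites an existing local state cannot be an entry.
  have key : ∀ {w : C.Val} {k : ℕ} {L1 L2 : Local C}, g.loc w k = some L1 →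
      (g.setLoc w k L2).loc v e = some L → False := by
    intro w k L1 L2 h1 h2
    rw [setLoc_loc] at h2
    split at h2
    · next hw => rw [hw.1, hw.2, h1] at hn; cases hn
    · rw [hn] at h2; cases h2
  cases h with
  | processTx w k L' tx active => exact (key active.2.1 hs).elim
  | processCert w k L' c r active => exact (key active.2.1 hs).elim
  | consensus k items => rw [hn] at hs; cases hs
  | processCommit w k L' items active => exact (key active.2.1 hs).elim
  | endOfEpoch w k L' active => exact (key active.2.1 hs).elim
  | handover w k L' active next_committee phase all_executed =>
    rw [setLoc_loc] at hs
    split at hs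
    · next hw =>
      obtain ⟨rfl, rfl⟩ := hw
      exact ⟨k, rfl, .inl ⟨L', active.2.1, phase, all_executed, (Option.some.inj hs).symm⟩⟩
    · rw [hn] at hs; cases hs
  | join w k X next_committee new not_entered synchronised =>
    rw [setLoc_loc] at hs
    split at hs
    · next hw =>
      obtain ⟨rfl, rfl⟩ := hw
      exact ⟨k, rfl, .inr ⟨X, synchronised, (Option.some.inj hs).symm⟩⟩
    · rw [hn] at hs; cases hs

/-! ### Growth of the logs and stability of the full node. -/

theorem Step.log_prefix (h : Step P cfg g g') (e : ℕ) : g.log e <+: g'.log e := by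
  cases h with
  | consensus k items =>
    by_cases hk : e = k
    · subst hk; simp
    · simp [hk]
  | _ => exact List.prefix_refl _

theorem IsRun.log_prefix (h : IsRun P cfg σ) {t t' : ℕ} (ht : t ≤ t') (e : ℕ) :
    (σ t).log e <+: (σ t').log e := by
  induction ht with
  | refl => exact List.prefix_refl _
  | step _ ih =>
    refine ih.trans ?_
    rcases h.2 _ with h' | h'
    · rw [Nat.succ_eq_add_one, h']
    · exact h'.log_prefix e

theorem fullNode_succ {log : ℕ → List (Commit C)} {X : Persistent C} :
    fullNode P cfg log (e + 1) = some X ↔ ∃ S, fullNode P cfg log e = some S ∧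
      (seqOf P cfg e S (log e)).contract.phase = .done ∧ X = nextStores P cfg e S (log e) := by
  rw [fullNode]
  cases hf : fullNode P cfg log e with
  | none => simp
  | some S =>
    simp only [Option.some.injEq, exists_eq_left']
    constructor
    · intro h
      split at h
      · next hd => exact ⟨hd, (Option.some.inj h).symm⟩
      · cases h
    · rintro ⟨hd, rfl⟩
      exact if_pos hd

/-- The full node passes an epoch only after its handover, and further commits of that epoch have no
effect. So its stores, once defined, never change. -/
theorem fullNode_mono {log log' : ℕ → List (Commit C)} (h : ∀ e, log e <+: log' e)
    {X : Persistent C} (hX : fullNode P cfg log e = some X) : fullNode P cfg log' e = some X := by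
  induction e generalizing X with
  | zero => exact hX
  | succ e ih =>
    obtain ⟨S, hS, hd, rfl⟩ := fullNode_succ.1 hX
    obtain ⟨m, hm⟩ := h e
    have : seqOf P cfg e S (log' e) = seqOf P cfg e S (log e) := by
      rw [← hm, seqOf, List.foldl_append]
      exact foldl_commit_of_done hd
    exact fullNode_succ.2 ⟨S, ih hS, by rw [this]; exact hd, by simp only [nextStores, this]⟩

theorem IsRun.fullNode_mono (h : IsRun P cfg σ) {t t' : ℕ} (ht : t ≤ t') {X : Persistent C}
    (hX : fullNode P cfg (σ t).log e = some X) : fullNode P cfg (σ t').log e = some X :=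
  Lutris.fullNode_mono (fun e => h.log_prefix ht e) hX

theorem IsRun.fullNode_unique (h : IsRun P cfg σ) {t t' : ℕ} {X Y : Persistent C}
    (hX : fullNode P cfg (σ t).log e = some X) (hY : fullNode P cfg (σ t').log e = some Y) :
    X = Y := by
  rcases le_total t t' with ht | ht
  · exact Option.some.inj ((h.fullNode_mono ht hX).symm.trans hY)
  · exact Option.some.inj (hX.symm.trans (h.fullNode_mono ht hY))

theorem Config.GenesisOK.good_genesisStores (h : cfg.GenesisOK P) :
    Good P cfg.genesisStores.objDB cfg.genesisStores.domain := by
  have : cfg.genesisStores.domain = ∅ := Set.eq_empty_of_forall_notMem fun _ hd => hd rfl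
  rw [this]
  exact h.good

/-- All validators enter epoch `e` with the stores `S`, those of a full node. -/
structure StartsWith (P : Platform C) (cfg : Config C) (σ : ℕ → Global C) (e : ℕ)
    (S : Persistent C) : Prop where
  good : Good P S.objDB S.domain
  full : ∀ {t X}, fullNode P cfg (σ t).log e = some X → X = S
  synchronised : ∀ {t v L}, (σ t).loc v e = some L → fullNode P cfg (σ t).log e = some S
  initial : ∀ {v L}, (σ 0).loc v e = some L → ∃ X : Persistent C, X.Same S ∧ L = X.enter
  entry : ∀ {t v L}, (σ t).loc v e = none → (σ (t + 1)).loc v e = some L →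
    ∃ X : Persistent C, X.Same S ∧ L = X.enter

/-! ### Induction on time within an epoch, and on epochs. -/

theorem Persistent.Same.refl (S : Persistent C) : S.Same S := ⟨rfl, rfl, fun _ => rfl⟩

theorem StartsWith.exists_inv (h : StartsWith P cfg σ e S) (run : IsRun P cfg σ)
    (sound : P.Sound) (bft : cfg.BFT) (t : ℕ) :
    ∃ l, EpochInv P cfg e S ((σ t).view e) l := by
  induction t with
  | zero =>
    have hsig : ∀ {v tx}, ¬ ((σ 0).view e).signed v tx := fun {v tx} => run.1.nothing_signed v e tx
    have hlog : ((σ 0).view e).log = [] := run.1.log_empty e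
    refine ⟨[], trivial, fun ht => (hsig ht).elim, fun ht => (hsig ht).elim,
      fun ht => (hsig ht).elim, fun ht => (hsig ht).elim, ?_, ?_, fun hloc => ?_⟩
    · rw [hlog]; intro items hi; simp at hi
    · rw [hlog]
      exact ⟨rfl, trivial, by simp [seqOf, SeqState.fresh, SeqState.records],
        by simp [seqOf, SeqState.fresh, SeqState.records]⟩
    · obtain ⟨X, hX, rfl⟩ := h.initial hloc
      exact hX.localInv
  | succ t ih =>
    obtain ⟨l, hl⟩ := ih
    rcases run.2 t with he | hs
    · rw [he]; exact ⟨l, hl⟩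
    · rcases hs.view e S fun v L => h.entry with he | hs
      · rw [he]; exact ⟨l, hl⟩
      · exact hl.step sound bft h.good hs

/-- A validator that hands over agrees with the full node by `EpochInv.carryOver_same`; one that
joins copies the full node. The stores of the full node do not depend on time, so one choice serves
all entries. -/
theorem StartsWith.next (h : StartsWith P cfg σ e S) (run : IsRun P cfg σ)
    (sound : P.Sound) (bft : cfg.BFT) (genesis : cfg.GenesisOK P) :
    ∃ S', StartsWith P cfg σ (e + 1) S' := by
  have hentry : ∀ {t v L}, (σ t).loc v (e + 1) = none → (σ (t + 1)).loc v (e + 1) = some L →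
      ∃ Y X : Persistent C, fullNode P cfg (σ t).log (e + 1) = some Y ∧ X.Same Y ∧ L = X.enter := by
    intro t v L hn hs
    rcases run.2 t with he | hstep
    · rw [he, hn] at hs; cases hs
    obtain ⟨k, hk, ⟨L0, hloc, hph, hall, rfl⟩ | ⟨X, hX, rfl⟩⟩ := hstep.entry hn hs
    · cases hk
      obtain ⟨l, hl⟩ := h.exists_inv run sound bft t
      obtain ⟨h1, h2⟩ := hl.carryOver_same sound bft h.good (v := v) hloc hph hall
      -- The presence of a validator in epoch `e` guarantees that the full node has reached it.
      exact ⟨_, _, fullNode_succ.2 ⟨S, h.synchronised hloc, h1, rfl⟩, h2, rfl⟩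
    · exact ⟨X, X, hX, .refl X, rfl⟩
  have hinit : ∀ {v L}, (σ 0).loc v (e + 1) = some L → False := by
    intro v L hL
    rw [run.1.not_running v (e + 1) (by simp)] at hL
    cases hL
  have hsync : ∀ t {v L}, (σ t).loc v (e + 1) = some L →
      ∃ Y, fullNode P cfg (σ t).log (e + 1) = some Y := by
    intro t
    induction t with
    | zero => exact fun hL => (hinit hL).elim
    | succ t ih =>
      intro v L hL
      have hle : t ≤ t + 1 := Nat.le_succ t
      cases hn : (σ t).loc v (e + 1) with
      | none =>
        obtain ⟨Y, X, hY, -⟩ := hentry hn hL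
        exact ⟨Y, run.fullNode_mono hle hY⟩
      | some L' =>
        obtain ⟨Y, hY⟩ := ih hn
        exact ⟨Y, run.fullNode_mono hle hY⟩
  by_cases hex : ∃ t Y, fullNode P cfg (σ t).log (e + 1) = some Y
  · obtain ⟨t0, Y, hY⟩ := hex
    refine ⟨Y, ?_, fun hX => run.fullNode_unique hX hY, fun {t v L} hL => ?_,
      fun hL => (hinit hL).elim, fun hn hs => ?_⟩
    · obtain ⟨S0, hS0, -, rfl⟩ := fullNode_succ.1 hY
      rw [h.full hS0]
      obtain ⟨l, hl⟩ := h.exists_inv run sound bft t0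
      exact hl.good_next sound bft h.good
    · obtain ⟨Z, hZ⟩ := hsync t hL
      rw [hZ, run.fullNode_unique hZ hY]
    · obtain ⟨Z, X, hZ, hX, rfl⟩ := hentry hn hs
      exact ⟨X, run.fullNode_unique hZ hY ▸ hX, rfl⟩
  · have hno : ∀ {t Y}, fullNode P cfg (σ t).log (e + 1) ≠ some Y := fun h => hex ⟨_, _, h⟩
    -- Nobody ever enters this epoch, so any well-formed stores will do.
    refine ⟨cfg.genesisStores, ?_, fun hX => (hno hX).elim, fun {t v L} hL => ?_,
      fun hL => (hinit hL).elim, fun hn hs => ?_⟩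
    · exact genesis.good_genesisStores
    · obtain ⟨Z, hZ⟩ := hsync t hL
      exact (hno hZ).elim
    · obtain ⟨Z, X, hZ, -⟩ := hentry hn hs
      exact (hno hZ).elim

theorem IsRun.exists_startsWith (run : IsRun P cfg σ) (sound : P.Sound) (bft : cfg.BFT)
    (genesis : cfg.GenesisOK P) (e : ℕ) : ∃ S, StartsWith P cfg σ e S := by
  induction e with
  | zero =>
    refine ⟨cfg.genesisStores, ?_, fun hX => (Option.some.inj hX).symm, fun _ => rfl,
      fun {v L} hL => ?_, fun {t v L} hn hs => ?_⟩
    · exact genesis.good_genesisStores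
    · by_cases hc : cfg.Correct 0 v
      · rw [run.1.running v hc] at hL
        exact ⟨_, .refl _, (Option.some.inj hL).symm⟩
      · rw [run.1.not_running v 0 (by simp [hc])] at hL
        cases hL
    · rcases run.2 t with he | hstep
      · rw [he, hn] at hs; cases hs
      · obtain ⟨k, hk, -⟩ := hstep.entry hn hs
        cases hk
  | succ e ih =>
    obtain ⟨S, hS⟩ := ih
    exact hS.next run sound bft genesis

theorem StartsWith.stores (h : StartsWith P cfg σ e S) {v : C.Val} {T : Stores C}
    (hT : StartsEpochWith σ v e T) : T = S.enter.stores := by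
  obtain ⟨t, L, hL, hfirst, rfl⟩ := hT
  obtain ⟨X, hX, rfl⟩ : ∃ X : Persistent C, X.Same S ∧ L = X.enter := by
    cases t with
    | zero => exact h.initial hL
    | succ t => exact h.entry (hfirst t (Nat.lt_succ_self t)) hL
  have hct : (fun d => anonymous (X.ct d)) = fun d => anonymous (S.ct d) := funext hX.ct
  have : X.enter.stores = ⟨X.objDB, fun _ => none, fun _ _ => none, X.nextShared,
    fun d => anonymous (X.ct d)⟩ := rfl
  rw [this, hX.objDB, hX.nextShared, hct]
  rfl

end runs

end Lutris

/-! ### The safety theorem. -/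

theorem mainTheorem1 {C : Lutris.Sorts.{u}} (P : Lutris.Platform C) (cfg : Lutris.Config C)
    (sound : P.Sound) (genesis : cfg.GenesisOK P) (bft : cfg.BFT)
    (σ : ℕ → Lutris.Global C) (run : Lutris.IsRun P cfg σ)
    (e : ℕ) (v w : C.Val) (hv : cfg.Correct e v) (hw : cfg.Correct e w)
    (S T : Lutris.Stores C)
    (startv : Lutris.StartsEpochWith σ v e S) (startw : Lutris.StartsEpochWith σ w e T) :
    S = T := by
  obtain ⟨X, hX⟩ := run.exists_startsWith sound bft genesis e
  rw [hX.stores startv, hX.stores startw]
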